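/- Let $(W,S)$ be a finite Coxeter system with Coxeter matrix $(m_{ij})$, $S=\{s_1,\dots,s_n\}$, realized as a group generated by orthogonal reflections of a finite-dimensional Euclidean space $V$: there are linearly independent unit vectors $\alpha_1,\dots,\alpha_n\in V$ with $\langle\alpha_i,\alpha_j\rangle=-\cos(\pi/m_{ij})$, and $s_i$ acts as the reflection in the hyperplane orthogonal to $\alpha_i$. Write $x^w=w^{-1}xw$, let $T=\{s^x : s\in S,\ x\in W\}$ be the set of reflections, $H_t=\ker(t-1)\subset V$ for $t\in T$, and $\mathcal A_W=\{H_t : t\in T\}$. A chamber is a connected component of $V\setminus\bigcup_{t\in T}H_t$; an edge is a nonempty intersection of one or more hyperplanes of $\mathcal A_W$. The weight of an edge $E$ is $\mathsf a(E)=\prod_{H\in\mathcal A_W,\,E\subseteq H}a_H\in\mathbb Z[a_H : H\in\mathcal A_W]$. Its multiplicity $l(E)$ is computed by choosing any $H\in\mathcal A_W$ with $E\subseteq H$ and taking half the number of chambers $C$ such that $E$ is the minimal edge containing $\overline C\cap H$. For $J\subseteq S$ let $W_J=\langle J\rangle$, let $T_J=T\cap W_J$, let $X_J$ be the set of elements $x$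 that have minimal length in their coset $W_Jx$, and let $[J]$ be the set of the conjugates $J^w$ $(w\in W)$ that are subsets of $S$; $J$ is irreducible if it is nonempty and is not a disjoint union of two nonempty subsets commuting elementwise with each other. For $K\subseteq J$ let $X(J,K)=\{w\in W_J\cap X_K\cap X_K^{-1} : K^w=K\}$. For $x\in W$ let the support $J(x)\subseteq S$ be the set of simple reflections occurring in a reduced expression of $x$, and let $\lfloor x\rceil$ be the set of conjugates $y$ of $x$ in $W$ with $J(y)=J(x)$. For $U\subseteq T$ let $E_U=\bigcap_{u\in U}H_u$. Theorem. (1) Let $E$ be an edge of $\mathcal A_W$. Then $l(E)\neq 0$ if and only if $E=E_{T_J^w}$ for some irreducible $J\subseteq S$ and some $w\in W$ (for whichever hyperplane $H\supseteq E$ is used to compute $l(E)$). (2) Let $J\subseteq S$ be irreducible and $w\in W$. Then $E_{T_J^w}$ is an edge, and $$\mathsf a(E_{T_J^w})=\prod_{u\in T_J}a_{H_{u^w}}.$$ There are a reflection $t_J$ with support $J$, a simple reflection $s_J$ and an element $v\in W$ such that $s_J^v$ is a reduced expression of $t_J$ (that is, $t_J=v^{-1}s_Jv$ has length $2\ell(v)+1$),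 and for every such choice, and every choice of the hyperplane $H\supseteq E_{T_J^w}$ used to compute the multiplicity, $$l(E_{T_J^w})=|\lfloor t_J\rceil|\cdot|[J]|\cdot|X(S,J)|\cdot|X(J,\{s_J\})|.$$ -/

import Mathlib

/-! ### Arrangements of hyperplanes

An arrangement is given as a set `A` of hyperplanes, each hyperplane being a subset of `V`. -/

namespace HypArr

variable {V : Type*}

/-- The chambers: the connected components of the complement of the union of the hyperplanes. -/
def chambers [TopologicalSpace V] (A : Set (Set V)) : Set (Set V) :=
  {C | ∃ x ∈ (⋃₀ A)ᶜ, C = connectedComponentIn (⋃₀ A)ᶜ x}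

/-- The edges: the nonempty intersections of (one or more) hyperplanes of the arrangement. -/
def edges (A : Set (Set V)) : Set (Set V) :=
  {E | E.Nonempty ∧ ∃ F ⊆ A, F.Nonempty ∧ E = ⋂₀ F}

/-- The weight `a(E)` of `E`: the product of the variables `a_H` over the hyperplanes `H ⊇ E`,
in the polynomial ring `ℤ[a_H | H ∈ A]`. -/
noncomputable def weight (A : Set (Set V)) (E : Set V) : MvPolynomial A ℤ :=
  ∏ᶠ (H : A) (_ : E ⊆ (H : Set V)), MvPolynomial.X H

/-- The multiplicity `l(E)` computed with the hyperplane `H ⊇ E`: half the number of chambers `C`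
such that `E` is the minimal edge containing `closure C ∩ H`. -/
noncomputable def multiplicity [TopologicalSpace V] (A : Set (Set V)) (E H : Set V) : ℚ :=
  ({C ∈ chambers A | IsLeast {F ∈ edges A | closure C ∩ H ⊆ F} E}.ncard : ℚ) / 2

end HypArr

/-! ### Combinatorics of a Coxeter group

Subsets of simple reflections are subsets of `W`; `x ^ w` means `w⁻¹ * x * w`. -/

namespace CoxeterSystem

variable {B W : Type*} [Group W] {M : CoxeterMatrix B} (cs : CoxeterSystem M W)

/-- The set `S` of simple reflections. -/
def simples : Set W := Set.range cs.simple

/-- `J ^ w`. -/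
def conjSet (J : Set W) (w : W) : Set W := (fun x => w⁻¹ * x * w) '' J

/-- The parabolic subgroup `W_J`. -/
def parabolic (J : Set W) : Subgroup W := Subgroup.closure J

/-- The set `T_J` of the reflections of `W` that lie in `W_J`. -/
def reflectionsIn (J : Set W) : Set W := {t | cs.IsReflection t ∧ t ∈ parabolic J}

/-- `X_J`: the elements of minimal length in their coset `W_J x`. -/
def minCosetReps (J : Set W) : Set W :=
  {x | ∀ u ∈ parabolic J, cs.length x ≤ cs.length (u * x)}

/-- The Coxeter class `[J]`: the conjugates of `J` that are subsets of `S`. -/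
def coxeterClass (J : Set W) : Set (Set W) := {K | K ⊆ cs.simples ∧ ∃ w : W, K = conjSet J w}

/-- `X(J, K) = {w ∈ W_J ∩ X_K ∩ X_K⁻¹ | K ^ w = K}`. -/
def normalizerReps (J K : Set W) : Set W :=
  {w | w ∈ parabolic J ∧ w ∈ cs.minCosetReps K ∧ w⁻¹ ∈ cs.minCosetReps K ∧ conjSet K w = K}

/-- A set `J` of simple reflections is irreducible if it is nonempty and is not the disjoint union
of two nonempty subsets that commute with each other elementwise (i.e. its Coxeter graph is
connected). -/
def IsIrreducible (J : Set W) : Prop :=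
  J.Nonempty ∧ ∀ K ⊆ J, K.Nonempty → (J \ K).Nonempty → ∃ s ∈ K, ∃ t ∈ J \ K, s * t ≠ t * s

/-- The support `J(x)`: the simple reflections that occur in a reduced expression of `x` (all
reduced expressions of `x` involve the same simple reflections). -/
def support (x : W) : Set W :=
  {s | ∃ ω : List B, cs.IsReduced ω ∧ cs.wordProd ω = x ∧ s ∈ ω.map cs.simple}

/-- `⌊x⌉`: the conjugates of `x` with the same support as `x`. -/
def sameSupportConjugates (x : W) : Set W := {y | cs.support y = cs.support x ∧ IsConj x y}

/-- `v⁻¹ s v` is a reduced expression of the reflection `t`, where `s` is a simple reflection: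
a reduced word of `v` together with `s` gives a word of length `2 ℓ(v) + 1` for `t`, which is
required to be reduced. -/
def IsReducedConj (t s v : W) : Prop :=
  s ∈ cs.simples ∧ t = v⁻¹ * s * v ∧ cs.length t = 2 * cs.length v + 1

/-- A realization of the Coxeter group as a group of orthogonal transformations of a Euclidean
space, generated by reflections: simple roots are linearly independent unit vectors, two of which
include the angle `π - π / m_ij`, and each simple reflection acts as the orthogonal reflection in
the hyperplane orthogonal to its root. The roots need not span the space. -/
structure Realization (V : Type*) [NormedAddCommGroup V] [InnerProductSpace ℝ V] where
  /-- The action of the group. -/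
  rep : W →* (V ≃ₗᵢ[ℝ] V)
  /-- The simple roots. -/
  root : B → V
  linearIndependent_root : LinearIndependent ℝ root
  inner_root : ∀ i j, inner ℝ (root i) (root j) = -Real.cos (Real.pi / M i j)
  rep_simple : ∀ i, rep (cs.simple i) = (ℝ ∙ root i)ᗮ.reflection

theorem isReflection_conj_of_mem {J : Set W} {u : W} (hu : u ∈ cs.reflectionsIn J) (w : W) :
    cs.IsReflection (w⁻¹ * u * w) := by
  simpa using hu.1.conj w⁻¹

namespace Realization

variable {cs} {V : Type*} [NormedAddCommGroup V] [InnerProductSpace ℝ V] (R : cs.Realization V)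

/-- `H_t = ker (t - 1)`. -/
def hyperplane (t : W) : Set V := {x | R.rep t x = x}

/-- The Coxeter arrangement `{H_t | t ∈ T}`. -/
def arrangement : Set (Set V) := {H | ∃ t, cs.IsReflection t ∧ H = R.hyperplane t}

/-- `E_U`, the intersection of the hyperplanes `H_u` with `u ∈ U`. -/
def edge (U : Set W) : Set V := ⋂ u ∈ U, R.hyperplane u

/-- The variable `a_{H_t}` attached to the hyperplane of a reflection `t`. -/
noncomputable def var (t : W) (ht : cs.IsReflection t) : MvPolynomial R.arrangement ℤ :=
  MvPolynomial.X ⟨R.hyperplane t, t, ht, rfl⟩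

end Realization

end CoxeterSystem

namespace CoxeterSystem

namespace Realization

variable {B W V : Type*} [Group W] {M : CoxeterMatrix B} {cs : CoxeterSystem M W}
  [NormedAddCommGroup V] [InnerProductSpace ℝ V] (R : cs.Realization V)

/-! ### Simple roots and the action of the simple reflections -/

/-! The chambers are the translates `R.chamber w` of the fundamental chamber, one for each `w`.
Write the positive root of a reflection `t` as a nonnegative combination of simple roots. On the
closed fundamental chamber this root vanishes exactly where every simple root occurring in it
vanishes, so the hyperplane of `t` cuts out a face spanning the flat of `rootSupport t`. Translating
by `w` gives `isLeast_edge` and `multiplicity_eq`: the multiplicity is half the number of `w` such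
that `w` carries the flat of the support of `w⁻¹ r w` to the given edge.

Part (1) follows from two facts. The support of a root is irreducible (`isIrreducible_rootSupport`).
For irreducible `J`, every reflection of `W_J` is conjugate in `W_J` to one of support `J`, because
a root that is dominant for `J` has full support (`exists_conj_rootSupport_eq`).

For (2), translate the edge to the flat of `J`, so that `r` lies in `W_J`, and factor `w = u d` with
`u ∈ W_J` and `d` minimal in its coset. The condition splits: `r ^ u` has support `J`, and `d⁻¹`
carries the simple roots of `J` to simple roots. Grouping the `d` by `J ^ d` gives `|[J]| |X(S,J)|`
(`ncard_carriesRoots`).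

The delicate factor is the number of `u`, since `r` need not be conjugate to `t_J`. It counts the
chambers of `W_J` whose closure meets the hyperplane of `r` only in the common kernel of all its
roots, that is, the cells that are bounded once this hyperplane is sent to infinity. Deletion and
contraction show that the count is the same for every hyperplane (`numBounded_eq`), so `r` may be
replaced by `t_J`. The map `u ↦ t_J ^ u` then goes onto `⌊t_J⌉`, with fibres the cosets of a
centralizer in `W_J`. Surjectivity uses that the Coxeter graph is a forest
(`exists_conj_simple_eq_of_isConj`). The centralizer has order `2 |X(J,{s_J})|`, and this 2 cancels
the half in the multiplicity. -/

theorem inner_root_self (i : B) : inner ℝ (R.root i) (R.root i) = 1 := by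
  rw [R.inner_root]; simp

theorem norm_root (i : B) : ‖R.root i‖ = 1 := by
  have h := R.inner_root_self i
  rw [real_inner_self_eq_norm_sq] at h
  nlinarith [norm_nonneg (R.root i)]

theorem rep_simple_apply (i : B) (x : V) :
    R.rep (cs.simple i) x = x - (2 * inner ℝ (R.root i) x) • R.root i := by
  rw [R.rep_simple, Submodule.reflection_orthogonal_apply, Submodule.reflection_singleton_apply,
    R.norm_root]
  simp only [RCLike.ofReal_real_eq_id, id, one_pow, div_one]
  module

theorem rep_simple_root (i : B) : R.rep (cs.simple i) (R.root i) = -R.root i := by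
  rw [R.rep_simple_apply, R.inner_root_self]
  module

theorem rep_mul_apply (u w : W) (x : V) : R.rep (u * w) x = R.rep u (R.rep w x) := by
  simp

theorem rep_inv_rep (w : W) (x : V) : R.rep w⁻¹ (R.rep w x) = x := by
  rw [← R.rep_mul_apply]; simp

theorem rep_rep_inv (w : W) (x : V) : R.rep w (R.rep w⁻¹ x) = x := by
  rw [← R.rep_mul_apply]; simp

theorem inner_rep_left (w : W) (x y : V) : inner ℝ (R.rep w x) y = inner ℝ x (R.rep w⁻¹ y) := by
  conv_lhs => rw [← R.rep_rep_inv w y]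
  exact LinearIsometryEquiv.inner_map_map _ _ _

theorem inner_rep_right (w : W) (x y : V) : inner ℝ x (R.rep w y) = inner ℝ (R.rep w⁻¹ x) y := by
  rw [R.inner_rep_left, inv_inv]

theorem root_ne_zero (i : B) : R.root i ≠ 0 := R.linearIndependent_root.ne_zero i

theorem root_injective : Function.Injective R.root := R.linearIndependent_root.injective

include R in
-- The entry 0 encodes infinite order, and `π / 0 = 0` would make the two roots opposite unit
-- vectors, against linear independence.
theorem coxeterMatrix_ne_zero (i j : B) : M i j ≠ 0 := by
  intro h
  have h1 := R.inner_root i j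
  rw [h] at h1
  simp only [Nat.cast_zero, div_zero, Real.cos_zero] at h1
  have h2 : R.root i + R.root j = 0 := by
    rw [← @inner_self_eq_zero ℝ, inner_add_left, inner_add_right, inner_add_right,
      R.inner_root_self, R.inner_root_self, real_inner_comm (R.root i) (R.root j), h1]
    norm_num
  have hij : i ≠ j := by
    rintro rfl
    have := R.inner_root_self i
    linarith
  have := (LinearIndependent.pair_iff.mp
    (R.linearIndependent_root.comp ![i, j] (by
      intro a b; fin_cases a <;> fin_cases b <;> simp [hij, hij.symm]) |> fun h => by
        convert h using 1; ext k; fin_cases k <;> rfl : LinearIndependent ℝ ![R.root i, R.root j]))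
    1 1 (by simpa using h2)
  exact one_ne_zero this.1

include R in
theorem two_le_coxeterMatrix {i j : B} (h : i ≠ j) : 2 ≤ M i j := by
  have h0 := R.coxeterMatrix_ne_zero i j
  have h1 := M.off_diagonal i j h
  omega

theorem inner_root_nonpos {i j : B} (h : i ≠ j) : inner ℝ (R.root i) (R.root j) ≤ 0 := by
  rw [R.inner_root, Left.neg_nonpos_iff]
  have h2 : (2 : ℝ) ≤ M i j := by exact_mod_cast R.two_le_coxeterMatrix h
  apply Real.cos_nonneg_of_neg_pi_div_two_le_of_le
  · have : 0 ≤ Real.pi / M i j := by positivity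
    linarith [Real.pi_pos]
  · exact div_le_div_of_nonneg_left Real.pi_pos.le (by norm_num) h2

/-- The orbit of a simple root under a dihedral group, by the recursion for `sin (k θ)`. The factor
`sin θ` avoids a division. The word ends in `j`, so `s_j` acts first. -/
theorem sin_smul_rep_alternatingWord (i j : B) (k : ℕ) :
    Real.sin (Real.pi / M i j) • R.rep (cs.wordProd (alternatingWord i j k)) (R.root i) =
      if Even k then
        Real.sin ((k + 1) * (Real.pi / M i j)) • R.root i +
          Real.sin (k * (Real.pi / M i j)) • R.root j
      else
        Real.sin ((k + 1) * (Real.pi / M i j)) • R.root j +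
          Real.sin (k * (Real.pi / M i j)) • R.root i := by
  set θ := Real.pi / M i j with hθ
  have hc : inner ℝ (R.root i) (R.root j) = -Real.cos θ := R.inner_root i j
  have hc' : inner ℝ (R.root j) (R.root i) = -Real.cos θ := by rw [real_inner_comm, hc]
  induction k with
  | zero => simp [alternatingWord]
  | succ k ih =>
    have hs : Real.sin ((k + 1 + 1) * θ) =
        2 * Real.cos θ * Real.sin ((k + 1) * θ) - Real.sin (k * θ) := by
      have h1 : ((k : ℝ) + 1 + 1) * θ = (k + 1) * θ + θ := by ring
      have h2 : (k : ℝ) * θ = (k + 1) * θ - θ := by ring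
      rw [h1, h2, Real.sin_add, Real.sin_sub]
      ring
    rw [alternatingWord_succ', wordProd_cons, R.rep_mul_apply, ← map_smul, ih]
    push_cast
    rw [hs]
    by_cases hk : Even k
    · simp only [hk, if_true, Nat.even_add_one, not_true_eq_false, if_false, R.rep_simple_apply,
        inner_add_right, inner_smul_right, hc', R.inner_root_self]
      module
    · simp only [hk, if_true, Nat.even_add_one, not_false_eq_true, if_false, R.rep_simple_apply,
        inner_add_right, inner_smul_right, hc, R.inner_root_self]
      module

end Realization

/-- Strip the descents `j`, `i`, `j`, ... from the right until neither letter is a descent; the two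
letters exchange roles at each step of the induction. -/
theorem exists_eq_mul_alternatingWord {B W : Type*} [Group W] {M : CoxeterMatrix B}
    (cs : CoxeterSystem M W) (n : ℕ) : ∀ (w : W) (i j : B), cs.length w = n →
      ¬ cs.IsRightDescent w i → ∃ v : W, ∃ k : ℕ, w = v * cs.wordProd (alternatingWord i j k) ∧
        cs.length v + k = cs.length w ∧ ¬ cs.IsRightDescent v i ∧ ¬ cs.IsRightDescent v j := by
  induction n with
  | zero =>
    intro w i j hw hi
    refine ⟨w, 0, by simp [alternatingWord], by simp, hi, ?_⟩
    simp [IsRightDescent, hw]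
  | succ n ih =>
    intro w i j hw hi
    by_cases hj : cs.IsRightDescent w j
    · have h1 := cs.isRightDescent_iff.mp hj
      obtain ⟨v, k, hv, hl, hvj, hvi⟩ := ih (w * cs.simple j) j i (by omega)
        (cs.isRightDescent_iff_not_isRightDescent_mul.mp hj)
      refine ⟨v, k + 1, ?_, by omega, hvi, hvj⟩
      rw [alternatingWord_succ, wordProd_concat, ← mul_assoc, ← hv,
        simple_mul_simple_cancel_right]
    · exact ⟨w, 0, by simp [alternatingWord], by simp, hi, hj⟩

namespace Realization

variable {B W V : Type*} [Group W] {M : CoxeterMatrix B} {cs : CoxeterSystem M W}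
  [NormedAddCommGroup V] [InnerProductSpace ℝ V] (R : cs.Realization V)

/-! ### Coweights and positivity of roots -/

variable [FiniteDimensional ℝ V]

theorem exists_inner_root_eq (c : B → ℝ) : ∃ z : V, ∀ i, inner ℝ z (R.root i) = c i := by
  obtain ⟨f, hf⟩ := LinearMap.exists_extend
    ((Module.Basis.span R.linearIndependent_root).constr ℝ c)
  refine ⟨(InnerProductSpace.toDual ℝ V).symm (LinearMap.toContinuousLinearMap f), fun i => ?_⟩
  rw [InnerProductSpace.toDual_symm_apply, LinearMap.coe_toContinuousLinearMap']
  have h := LinearMap.congr_fun hf (Module.Basis.span R.linearIndependent_root i)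
  rw [Module.Basis.constr_basis, LinearMap.comp_apply, Submodule.subtype_apply,
    Module.Basis.span_apply] at h
  exact h

open Classical in
/-- A family of vectors dual to the simple roots. -/
noncomputable def coweight (i : B) : V :=
  (R.exists_inner_root_eq fun j => if i = j then 1 else 0).choose

open Classical in
theorem inner_coweight_root (i j : B) :
    inner ℝ (R.coweight i) (R.root j) = if i = j then 1 else 0 :=
  (R.exists_inner_root_eq fun j => if i = j then 1 else 0).choose_spec j

/-- Write `w = v d` with `d` an alternating word in `i` and a right descent `j`, and `v` without
descents `i`, `j`. Then `d` sends the root of `i` to a nonnegative combination of the two roots, and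
induction applies to the shorter `v`. -/
theorem inner_coweight_rep_nonneg {w : W} {i : B} (h : ¬ cs.IsRightDescent w i) (k : B) :
    0 ≤ inner ℝ (R.coweight k) (R.rep w (R.root i)) := by
  induction hn : cs.length w using Nat.strong_induction_on generalizing w i with
  | _ n ih =>
  subst hn
  by_cases hw : w = 1
  · subst hw
    rw [map_one, LinearIsometryEquiv.coe_one, id, R.inner_coweight_root]
    split_ifs <;> norm_num
  obtain ⟨j, hj⟩ := cs.exists_rightDescent_of_ne_one hw
  have hij : i ≠ j := by rintro rfl; exact h hj
  obtain ⟨v, m, hv, hl, hvi, hvj⟩ := cs.exists_eq_mul_alternatingWord _ w i j rfl h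
  have hm0 : m ≠ 0 := by
    rintro rfl
    rw [alternatingWord, wordProd_nil, mul_one] at hv
    exact hvj (hv ▸ hj)
  have hM := R.coxeterMatrix_ne_zero i j
  -- Since `w s_i` is longer than `w` and equals `v` times the alternating word of length `m + 1`,
  -- that word is reduced, so its length is at most `M i j`. This keeps the angles below within `[0,
  -- π]`.
  have hmM : m + 1 ≤ M i j := by
    by_contra hcon
    apply cs.not_isReduced_alternatingWord j i (m := m + 1) (by rwa [M.symmetric])
      (by rw [M.symmetric]; omega)
    have h1 := (cs.not_isRightDescent_iff).mp h
    have h2 := cs.length_mul_le v (cs.wordProd (alternatingWord j i (m + 1)))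
    rw [alternatingWord_succ, wordProd_concat, ← mul_assoc, ← hv] at h2
    have h3 := cs.length_wordProd_le (alternatingWord j i (m + 1))
    rw [length_alternatingWord] at h3
    rw [IsReduced, length_alternatingWord]
    rw [alternatingWord_succ, wordProd_concat] at h3 ⊢
    omega
  have hMr : (2 : ℝ) ≤ M i j := by exact_mod_cast R.two_le_coxeterMatrix hij
  have hpos : 0 < Real.pi / M i j := by positivity
  have hsin : ∀ a : ℝ, 0 ≤ a → a ≤ M i j → 0 ≤ Real.sin (a * (Real.pi / M i j)) := by
    intro a h0 h1
    apply Real.sin_nonneg_of_nonneg_of_le_pi (by positivity)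
    calc a * (Real.pi / M i j) ≤ M i j * (Real.pi / M i j) := by gcongr
      _ = Real.pi := by field_simp
  have hs0 : 0 < Real.sin (Real.pi / M i j) := by
    apply Real.sin_pos_of_pos_of_lt_pi hpos
    rw [div_lt_iff₀ (by linarith)]
    nlinarith [Real.pi_pos]
  have hi := ih _ (by omega) hvi rfl
  have hj' := ih _ (by omega) hvj rfl
  have hmr : (m : ℝ) + 1 ≤ M i j := by exact_mod_cast hmM
  have ha := hsin (m + 1) (by positivity) hmr
  have hb := hsin m (by positivity) (by linarith)
  refine (mul_nonneg_iff_of_pos_left hs0).mp ?_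
  rw [← inner_smul_right, hv, R.rep_mul_apply, ← map_smul,
    R.sin_smul_rep_alternatingWord]
  split_ifs <;> rw [map_add, map_smul, map_smul, inner_add_right, inner_smul_right,
    inner_smul_right] <;> positivity

end Realization
end CoxeterSystem

namespace CoxeterSystem

namespace Realization

variable {B W V : Type*} [Group W] {M : CoxeterMatrix B} {cs : CoxeterSystem M W}
  [NormedAddCommGroup V] [InnerProductSpace ℝ V] (R : cs.Realization V)

/-! ### Roots -/

/-- The roots: the images of the simple roots under the group. -/
def IsRoot (β : V) : Prop := ∃ w i, β = R.rep w (R.root i)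

theorem isRoot_root (i : B) : R.IsRoot (R.root i) := ⟨1, i, by simp⟩

variable {R} in
theorem IsRoot.rep {β : V} (h : R.IsRoot β) (w : W) : R.IsRoot (R.rep w β) := by
  obtain ⟨u, i, rfl⟩ := h
  exact ⟨w * u, i, by rw [R.rep_mul_apply]⟩

variable {R} in
theorem IsRoot.neg {β : V} (h : R.IsRoot β) : R.IsRoot (-β) := by
  obtain ⟨u, i, rfl⟩ := h
  exact ⟨u * cs.simple i, i, by rw [R.rep_mul_apply, R.rep_simple_root, map_neg]⟩

variable {R} in
theorem IsRoot.inner_self {β : V} (h : R.IsRoot β) : inner ℝ β β = 1 := by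
  obtain ⟨u, i, rfl⟩ := h
  rw [LinearIsometryEquiv.inner_map_map, R.inner_root_self]

variable {R} in
theorem IsRoot.ne_zero {β : V} (h : R.IsRoot β) : β ≠ 0 := by
  rintro rfl
  simpa using h.inner_self

theorem parabolic_induction {K : Set B} {p : W → Prop} (one : p 1)
    (mul : ∀ i ∈ K, ∀ v, p v → p (cs.simple i * v)) {w : W}
    (hw : w ∈ parabolic (cs.simple '' K)) : p w := by
  induction hw using Subgroup.closure_induction_left with
  | one => exact one
  | mul_left x hx y _ h =>
    obtain ⟨i, hi, rfl⟩ := hx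
    exact mul i hi y h
  | inv_mul_cancel x hx y _ h =>
    obtain ⟨i, hi, rfl⟩ := hx
    rw [cs.inv_simple]
    exact mul i hi y h

theorem simple_mem_parabolic {K : Set B} {i : B} (hi : i ∈ K) :
    cs.simple i ∈ parabolic (cs.simple '' K) := Subgroup.subset_closure ⟨i, hi, rfl⟩

theorem wordProd_mem_parabolic {K : Set B} {ω : List B} (h : ∀ i ∈ ω, i ∈ K) :
    cs.wordProd ω ∈ parabolic (cs.simple '' K) := by
  induction ω with
  | nil => rw [wordProd_nil]; exact one_mem _
  | cons i ω ih =>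
    rw [wordProd_cons]
    exact mul_mem (simple_mem_parabolic (h i (by simp))) (ih fun j hj => h j (by simp [hj]))

theorem mem_parabolic_univ (w : W) : w ∈ parabolic (cs.simple '' Set.univ) := by
  rw [Set.image_univ, parabolic, cs.subgroup_closure_range_simple]
  trivial

theorem rep_mem_span {K : Set B} {w : W} (hw : w ∈ parabolic (cs.simple '' K)) {x : V}
    (hx : x ∈ Submodule.span ℝ (R.root '' K)) : R.rep w x ∈ Submodule.span ℝ (R.root '' K) := by
  refine parabolic_induction (p := fun w => R.rep w x ∈ _) (by simpa using hx) ?_ hw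
  · intro i hi v hv
    rw [R.rep_mul_apply, R.rep_simple_apply]
    exact Submodule.sub_mem _ hv
      (Submodule.smul_mem _ _ (Submodule.subset_span ⟨i, hi, rfl⟩))

theorem rep_eq_self_of_mem_parabolic {K : Set B} {w : W}
    (hw : w ∈ parabolic (cs.simple '' K)) {x : V} (hx : ∀ i ∈ K, inner ℝ (R.root i) x = 0) :
    R.rep w x = x := by
  refine parabolic_induction (p := fun w => R.rep w x = x) (by simp) (fun i hi v hv => ?_) hw
  rw [R.rep_mul_apply, hv, R.rep_simple_apply, hx i hi]; simp

variable {R} in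
theorem IsRoot.mem_span {β : V} (h : R.IsRoot β) : β ∈ Submodule.span ℝ (Set.range R.root) := by
  obtain ⟨u, i, rfl⟩ := h
  rw [← Set.image_univ]
  exact R.rep_mem_span (mem_parabolic_univ u) (Submodule.subset_span ⟨i, trivial, rfl⟩)

/-! ### Positive and negative roots -/

section FiniteDimensional

variable [FiniteDimensional ℝ V]

/-- The nonnegative linear combinations of simple roots, in terms of the coordinate functionals. -/
def IsNonneg (x : V) : Prop := ∀ k, 0 ≤ inner ℝ (R.coweight k) x

theorem isNonneg_root (i : B) : R.IsNonneg (R.root i) := by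
  intro k
  rw [R.inner_coweight_root]
  split_ifs <;> norm_num

theorem isNonneg_rep {w : W} {i : B} (h : ¬ cs.IsRightDescent w i) :
    R.IsNonneg (R.rep w (R.root i)) := R.inner_coweight_rep_nonneg h

theorem isNonneg_neg_rep {w : W} {i : B} (h : cs.IsRightDescent w i) :
    R.IsNonneg (-R.rep w (R.root i)) := by
  rw [← map_neg, ← R.rep_simple_root, ← R.rep_mul_apply]
  exact R.isNonneg_rep (cs.isRightDescent_iff_not_isRightDescent_mul.mp h)

variable {R} in
theorem IsRoot.isNonneg_or {β : V} (h : R.IsRoot β) : R.IsNonneg β ∨ R.IsNonneg (-β) := by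
  obtain ⟨w, i, rfl⟩ := h
  by_cases hd : cs.IsRightDescent w i
  · exact .inr (R.isNonneg_neg_rep hd)
  · exact .inl (R.isNonneg_rep hd)

theorem eq_sum_coweight [Fintype B] {x : V} (hx : x ∈ Submodule.span ℝ (Set.range R.root)) :
    x = ∑ i, inner ℝ (R.coweight i) x • R.root i := by
  classical
  obtain ⟨c, rfl⟩ := (Submodule.mem_span_range_iff_exists_fun ℝ).mp hx
  refine Finset.sum_congr rfl fun i _ => ?_
  rw [inner_sum]
  simp [inner_smul_right, R.inner_coweight_root]

theorem mem_span_of_inner_coweight_eq_zero [Finite B] {K : Set B} {x : V}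
    (hx : x ∈ Submodule.span ℝ (Set.range R.root))
    (h : ∀ k ∉ K, inner ℝ (R.coweight k) x = 0) : x ∈ Submodule.span ℝ (R.root '' K) := by
  cases nonempty_fintype B
  rw [R.eq_sum_coweight hx]
  refine Submodule.sum_mem _ fun i _ => ?_
  by_cases hi : i ∈ K
  · exact Submodule.smul_mem _ _ (Submodule.subset_span ⟨i, hi, rfl⟩)
  · rw [h i hi, zero_smul]; exact Submodule.zero_mem _

theorem inner_coweight_eq_zero_of_mem_span {K : Set B} {x : V}
    (hx : x ∈ Submodule.span ℝ (R.root '' K)) {k : B} (hk : k ∉ K) :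
    inner ℝ (R.coweight k) x = 0 := by
  induction hx using Submodule.span_induction with
  | mem y hy =>
    obtain ⟨i, hi, rfl⟩ := hy
    rw [R.inner_coweight_root, if_neg]
    rintro rfl
    exact hk hi
  | zero => simp
  | add y z _ _ hy hz => rw [inner_add_right, hy, hz, add_zero]
  | smul a y _ hy => rw [inner_smul_right, hy, mul_zero]

variable {R} in
theorem IsRoot.not_isNonneg_neg [Finite B] {β : V} (h : R.IsRoot β) (hp : R.IsNonneg β) :
    ¬ R.IsNonneg (-β) := by
  intro hn
  cases nonempty_fintype B
  apply h.ne_zero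
  rw [R.eq_sum_coweight h.mem_span]
  refine Finset.sum_eq_zero fun i _ => ?_
  have h1 := hp i
  have h2 := hn i
  rw [inner_neg_right] at h2
  rw [show inner ℝ (R.coweight i) β = 0 by linarith, zero_smul]

theorem isNonneg_rep_iff [Finite B] {w : W} {i : B} :
    R.IsNonneg (R.rep w (R.root i)) ↔ ¬ cs.IsRightDescent w i := by
  refine ⟨fun h hd => ?_, R.isNonneg_rep⟩
  exact IsRoot.not_isNonneg_neg ⟨w, i, rfl⟩ h (R.isNonneg_neg_rep hd)

theorem eq_one_of_isNonneg [Finite B] {w : W} (h : ∀ i, R.IsNonneg (R.rep w (R.root i))) :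
    w = 1 := by
  by_contra hw
  obtain ⟨i, hi⟩ := cs.exists_rightDescent_of_ne_one hw
  exact R.isNonneg_rep_iff.mp (h i) hi

theorem rep_injective [Finite B] : Function.Injective R.rep := by
  rw [injective_iff_map_eq_one]
  intro w hw
  refine R.eq_one_of_isNonneg fun i => ?_
  rw [hw]
  exact R.isNonneg_root i

include R in
theorem simple_injective [Finite B] : Function.Injective cs.simple := by
  intro i j h
  have h1 : R.rep (cs.simple i) (R.root i) = R.rep (cs.simple j) (R.root i) := by rw [h]
  rw [R.rep_simple_root, R.rep_simple_apply] at h1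
  have h2 : (1 : ℝ) • R.root i = inner ℝ (R.root j) (R.root i) • R.root j := by
    have : (2 : ℝ) • R.root i = (2 * inner ℝ (R.root j) (R.root i)) • R.root j := by
      rw [← sub_eq_zero] at h1 ⊢
      rw [← neg_eq_zero, ← h1]; module
    rw [mul_smul] at this
    rw [one_smul]
    exact smul_right_injective V (two_ne_zero (α := ℝ)) this
  by_contra hij
  have h3 := congrArg (inner ℝ (R.coweight i)) h2
  rw [inner_smul_right, inner_smul_right, R.inner_coweight_root, R.inner_coweight_root] at h3
  simp [hij] at h3

/-! ### Positive roots of reflections -/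

theorem exists_posRoot {t : W} (ht : cs.IsReflection t) : ∃ β, R.IsRoot β ∧ R.IsNonneg β ∧
    ∀ x, R.rep t x = x - (2 * inner ℝ β x) • β := by
  obtain ⟨w, i, rfl⟩ := ht
  have hβ : R.IsRoot (R.rep w (R.root i)) := ⟨w, i, rfl⟩
  have h : ∀ x, R.rep (w * cs.simple i * w⁻¹) x =
      x - (2 * inner ℝ (R.rep w (R.root i)) x) • R.rep w (R.root i) := by
    intro x
    rw [R.rep_mul_apply, R.rep_mul_apply, R.rep_simple_apply, map_sub, map_smul, R.rep_rep_inv,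
      R.inner_rep_left]
  rcases hβ.isNonneg_or with hn | hn
  · exact ⟨_, hβ, hn, h⟩
  · refine ⟨_, hβ.neg, hn, fun x => ?_⟩
    rw [h, inner_neg_left]
    module

open Classical in
/-- The positive root orthogonal to the hyperplane of a reflection. -/
noncomputable def posRoot (t : W) : V :=
  if ht : cs.IsReflection t then (R.exists_posRoot ht).choose else 0

variable {t : W} (ht : cs.IsReflection t)
include ht

theorem isRoot_posRoot : R.IsRoot (R.posRoot t) := by
  rw [posRoot, dif_pos ht]; exact (R.exists_posRoot ht).choose_spec.1

theorem isNonneg_posRoot : R.IsNonneg (R.posRoot t) := by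
  rw [posRoot, dif_pos ht]; exact (R.exists_posRoot ht).choose_spec.2.1

theorem rep_reflection_apply (x : V) :
    R.rep t x = x - (2 * inner ℝ (R.posRoot t) x) • R.posRoot t := by
  rw [posRoot, dif_pos ht]; exact (R.exists_posRoot ht).choose_spec.2.2 x

theorem mem_hyperplane_iff {x : V} : x ∈ R.hyperplane t ↔ inner ℝ (R.posRoot t) x = 0 := by
  rw [hyperplane, Set.mem_ofPred_eq, R.rep_reflection_apply ht, sub_eq_self, smul_eq_zero]
  simp [(R.isRoot_posRoot ht).ne_zero]

/-- The `-1`-eigenspace of a reflection is a line and roots are unit vectors, so only the sign is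
left to determine. -/
theorem eq_posRoot [Finite B] {β : V} (hβ : R.IsRoot β) (hn : R.IsNonneg β)
    (h : R.rep t β = -β) : β = R.posRoot t := by
  set γ := R.posRoot t
  rw [R.rep_reflection_apply ht] at h
  set c := inner ℝ γ β with hc
  have h1 : β = c • γ := by
    have h2 : (2 : ℝ) • (β - c • γ) = 0 := by
      rw [← sub_eq_zero] at h
      rw [← h]; module
    rwa [smul_eq_zero_iff_right two_ne_zero, sub_eq_zero] at h2
  have hγ : R.IsRoot γ := R.isRoot_posRoot ht
  have h3 := hβ.inner_self
  rw [h1, inner_smul_left, inner_smul_right, hγ.inner_self] at h3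
  simp only [conj_trivial, mul_one] at h3
  rcases mul_self_eq_one_iff.mp h3 with h4 | h4
  · rw [h1, h4, one_smul]
  · rw [h4, neg_one_smul] at h1
    exact absurd (h1 ▸ hn) (hγ.not_isNonneg_neg (R.isNonneg_posRoot ht))

theorem rep_posRoot_self : R.rep t (R.posRoot t) = -R.posRoot t := by
  rw [R.rep_reflection_apply ht, (R.isRoot_posRoot ht).inner_self]; module

theorem posRoot_conj_of_isNonneg [Finite B] {w : W} (h : R.IsNonneg (R.rep w (R.posRoot t))) :
    R.posRoot (w * t * w⁻¹) = R.rep w (R.posRoot t) := by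
  symm
  apply R.eq_posRoot (ht.conj w) ((R.isRoot_posRoot ht).rep w) h
  rw [← R.rep_mul_apply, inv_mul_cancel_right, R.rep_mul_apply, R.rep_posRoot_self ht, map_neg]

theorem posRoot_conj_of_isNonneg_neg [Finite B] {w : W}
    (h : R.IsNonneg (-R.rep w (R.posRoot t))) :
    R.posRoot (w * t * w⁻¹) = -R.rep w (R.posRoot t) := by
  symm
  apply R.eq_posRoot (ht.conj w) ((R.isRoot_posRoot ht).rep w).neg h
  rw [← map_neg, ← R.rep_mul_apply, inv_mul_cancel_right, R.rep_mul_apply, map_neg,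
    R.rep_posRoot_self ht, map_neg, map_neg]

omit ht in
theorem posRoot_simple [Finite B] (i : B) : R.posRoot (cs.simple i) = R.root i :=
  (R.eq_posRoot (cs.isReflection_simple i) (R.isRoot_root i) (R.isNonneg_root i)
    (R.rep_simple_root i)).symm

theorem eq_of_posRoot_eq [Finite B] {t' : W} (ht' : cs.IsReflection t')
    (h : R.posRoot t = R.posRoot t') : t = t' := by
  apply R.rep_injective
  ext x
  rw [R.rep_reflection_apply ht, R.rep_reflection_apply ht', h]

end FiniteDimensional

end Realization
end CoxeterSystem

/-! ### Cells of a family of linear functionals that are relatively bounded -/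

namespace LinearCells

variable {E ι : Type*} [AddCommGroup E] [Module ℝ E]

theorem exists_pos_forall_add_mul_pos (s : Finset ι) {a : ι → ℝ} (b : ι → ℝ)
    (ha : ∀ j ∈ s, 0 < a j) : ∃ ε > 0, ∀ j ∈ s, 0 < a j + ε * b j := by
  have h : ∀ᶠ ε in nhdsWithin (0 : ℝ) (Set.Ioi 0), ∀ j ∈ s, 0 < a j + ε * b j := by
    rw [Filter.eventually_all_finset]
    intro j hj
    have hc : Filter.Tendsto (fun ε : ℝ => a j + ε * b j) (nhdsWithin 0 (Set.Ioi 0))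
        (nhds (a j + 0 * b j)) := by
      apply Filter.Tendsto.mono_left _ nhdsWithin_le_nhds
      exact Continuous.tendsto (by fun_prop) 0
    exact hc.eventually (lt_mem_nhds (by simpa using ha j hj))
  obtain ⟨ε, h1, h2⟩ := (h.and self_mem_nhdsWithin).exists
  exact ⟨ε, h2, h1⟩

variable (f : ι → E →ₗ[ℝ] ℝ)

/-- The open cell with signs `σ` of the functionals indexed by `s` meets the set `U`. -/
def IsRealizable (U : Set E) (s : Finset ι) (σ : ι → ℝ) : Prop :=
  ∃ x ∈ U, ∀ j ∈ s, 0 < σ j * f j x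

/-- The trace on `U` of the closed cell with signs `σ` of the functionals indexed by `s` meets the
kernel of the functional `i` only where all functionals vanish. -/
def IsBounded (U : Set E) (s : Finset ι) (i : ι) (σ : ι → ℝ) : Prop :=
  ∀ y ∈ U, (∀ j ∈ s, 0 ≤ σ j * f j y) → f i y = 0 → ∀ j ∈ s, f j y = 0

variable {f} {U : Submodule ℝ E} {s : Finset ι} {i : ι} {σ : ι → ℝ} {g : E →ₗ[ℝ] ℝ}

/-- Cells are open, so a point of the cell on the kernel of `g` can be pushed off it. -/
theorem isRealizable_iff_or (hg : ∃ x ∈ U, g x ≠ 0) :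
    IsRealizable f U s σ ↔ IsRealizable f (U ∩ {x | 0 < g x}) s σ ∨
      IsRealizable f (U ∩ {x | g x < 0}) s σ := by
  constructor
  · rintro ⟨x, hx, h⟩
    rcases lt_trichotomy (g x) 0 with h0 | h0 | h0
    · exact .inr ⟨x, ⟨hx, h0⟩, h⟩
    · obtain ⟨e, he, hge⟩ := hg
      obtain ⟨ε, hε, hpos⟩ := exists_pos_forall_add_mul_pos s (fun j => σ j * f j e) h
      have hge' : g (x + ε • e) ≠ 0 := by simp [h0, hge, hε.ne']
      have hcell : ∀ j ∈ s, 0 < σ j * f j (x + ε • e) := fun j hj => by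
        have := hpos j hj
        simp only [map_add, map_smul, smul_eq_mul]
        linarith
      have hmem : x + ε • e ∈ U := U.add_mem hx (U.smul_mem _ he)
      rcases hge'.lt_or_gt with h1 | h1
      · exact .inr ⟨_, ⟨hmem, h1⟩, hcell⟩
      · exact .inl ⟨_, ⟨hmem, h1⟩, hcell⟩
    · exact .inl ⟨x, ⟨hx, h0⟩, h⟩
  · rintro (⟨x, hx, h⟩ | ⟨x, hx, h⟩)
    · exact ⟨x, hx.1, h⟩
    · exact ⟨x, hx.1, h⟩

/-- Openness moves a point of the kernel to both sides; convexity joins points on the two sides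
through the kernel. -/
theorem isRealizable_ker_iff_and (hg : ∃ x ∈ U, g x ≠ 0) :
    IsRealizable f (U ⊓ LinearMap.ker g : Submodule ℝ E) s σ ↔
      IsRealizable f (U ∩ {x | 0 < g x}) s σ ∧ IsRealizable f (U ∩ {x | g x < 0}) s σ := by
  constructor
  · rintro ⟨x, ⟨hx, hx0⟩, h⟩
    replace hx0 : g x = 0 := hx0
    obtain ⟨e, he, hge⟩ := hg
    have key : ∀ e ∈ U, ∃ ε > (0 : ℝ), ∀ j ∈ s, 0 < σ j * f j (x + ε • e) := by
      intro e he
      obtain ⟨ε, hε, hpos⟩ := exists_pos_forall_add_mul_pos s (fun j => σ j * f j e) h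
      refine ⟨ε, hε, fun j hj => ?_⟩
      have := hpos j hj
      simp only [map_add, map_smul, smul_eq_mul]
      linarith
    have key2 : ∀ e ∈ U, 0 < g e → IsRealizable f (U ∩ {x | 0 < g x}) s σ ∧
        IsRealizable f (U ∩ {x | g x < 0}) s σ := by
      intro e he hpos
      obtain ⟨ε, hε, h1⟩ := key e he
      obtain ⟨δ, hδ, h2⟩ := key (-e) (U.neg_mem he)
      refine ⟨⟨_, ⟨U.add_mem hx (U.smul_mem _ he), ?_⟩, h1⟩,
        ⟨_, ⟨U.add_mem hx (U.smul_mem _ (U.neg_mem he)), ?_⟩, h2⟩⟩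
      · simp only [Set.mem_ofPred_eq, map_add, map_smul, hx0, smul_eq_mul, zero_add]
        positivity
      · simp only [Set.mem_ofPred_eq, map_add, map_smul, hx0, smul_eq_mul, zero_add, map_neg]
        nlinarith [mul_pos hδ hpos]
    rcases hge.lt_or_gt with h0 | h0
    · exact key2 (-e) (U.neg_mem he) (by simpa using h0)
    · exact key2 e he h0
  · rintro ⟨⟨x, ⟨hx, hgx⟩, h⟩, ⟨y, ⟨hy, hgy⟩, h'⟩⟩
    replace hgx : 0 < g x := hgx
    replace hgy : g y < 0 := hgy
    refine ⟨(-g y) • x + g x • y, ⟨U.add_mem (U.smul_mem _ hx) (U.smul_mem _ hy), ?_⟩,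
      fun j hj => ?_⟩
    · simp only [SetLike.mem_coe, LinearMap.mem_ker, map_add, map_smul, smul_eq_mul]
      ring
    · have h1 := mul_pos (neg_pos.mpr hgy) (h j hj)
      have h2 := mul_pos hgx (h' j hj)
      simp only [map_add, map_smul, smul_eq_mul]
      linarith

theorem isBounded_iff_and :
    IsBounded f U s i σ ↔ IsBounded f (U ∩ {x | 0 ≤ g x}) s i σ ∧
      IsBounded f (U ∩ {x | g x ≤ 0}) s i σ := by
  constructor
  · exact fun h => ⟨fun y hy => h y hy.1, fun y hy => h y hy.1⟩
  · rintro ⟨h1, h2⟩ y hy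
    rcases le_total 0 (g y) with h | h
    · exact h1 y ⟨hy, h⟩
    · exact h2 y ⟨hy, h⟩

/-- Witnesses against boundedness on both sides combine to one on the kernel of `g`: the signed
values are nonnegative, so nothing cancels. -/
theorem isBounded_ker_iff_or (hσ : ∀ j ∈ s, σ j ≠ 0) :
    IsBounded f (U ⊓ LinearMap.ker g : Submodule ℝ E) s i σ ↔
      IsBounded f (U ∩ {x | 0 ≤ g x}) s i σ ∨ IsBounded f (U ∩ {x | g x ≤ 0}) s i σ := by
  constructor
  · intro h
    by_contra! hcon
    simp only [IsBounded] at hcon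
    push Not at hcon
    obtain ⟨⟨y, ⟨hy, hgy⟩, hyc, hyi, j, hj, hyj⟩, ⟨z, ⟨hz, hgz⟩, hzc, hzi, k, hk, hzk⟩⟩ := hcon
    replace hgy : 0 ≤ g y := hgy
    replace hgz : g z ≤ 0 := hgz
    rcases hgy.eq_or_lt with h0 | h0
    · exact hyj (h y ⟨hy, h0.symm⟩ hyc hyi j hj)
    have h1 := h ((-g z) • y + g y • z) ⟨U.add_mem (U.smul_mem _ hy) (U.smul_mem _ hz), by
      simp only [SetLike.mem_coe, LinearMap.mem_ker, map_add, map_smul, smul_eq_mul]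
      ring⟩ (fun j hj => by
        have h1 := mul_nonneg (neg_nonneg.mpr hgz) (hyc j hj)
        have h2 := mul_nonneg hgy (hzc j hj)
        simp only [map_add, map_smul, smul_eq_mul]
        linarith) (by simp [hyi, hzi]) k hk
    simp only [map_add, map_smul, smul_eq_mul] at h1
    have h2 := mul_nonneg (neg_nonneg.mpr hgz) (hyc k hk)
    have h3 : 0 < g y * (σ k * f k z) :=
      mul_pos h0 ((hzc k hk).lt_of_ne' (mul_ne_zero (hσ k hk) hzk))
    have h4 : σ k * (-g z * f k y + g y * f k z) = 0 := by rw [h1, mul_zero]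
    linarith
  · rintro (h | h) y ⟨hy, hgy⟩
    · exact h y ⟨hy, (show g y = 0 from hgy).ge⟩
    · exact h y ⟨hy, (show g y = 0 from hgy).le⟩

/-- If the open cell avoids the negative side of `g`, so does the closed cell; its points with `g ≤
0` then already satisfy `0 ≤ g`. -/
theorem isBounded_nonpos_of_nonneg (hp : IsRealizable f (U ∩ {x | 0 < g x}) s σ)
    (hm : ¬ IsRealizable f (U ∩ {x | g x < 0}) s σ)
    (h : IsBounded f (U ∩ {x | 0 ≤ g x}) s i σ) : IsBounded f (U ∩ {x | g x ≤ 0}) s i σ := by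
  rintro y ⟨hy, hgy⟩ hyc
  refine h y ⟨hy, ?_⟩ hyc
  by_contra hneg
  replace hneg : 0 < -g y := by simpa using hneg
  obtain ⟨x, ⟨hx, hgx⟩, hxc⟩ := hp
  replace hgx : 0 < g x := hgx
  -- The coefficient 2 makes the value of `g` equal to `g x * g y < 0`; the positive multiple of `x`
  -- puts the point in the open cell.
  refine hm ⟨(2 * g x) • y + (-g y) • x, ⟨U.add_mem (U.smul_mem _ hy) (U.smul_mem _ hx), ?_⟩,
    fun j hj => ?_⟩
  · simp only [Set.mem_ofPred_eq, map_add, map_smul, smul_eq_mul]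
    nlinarith
  · have h1 := mul_nonneg (mul_nonneg zero_le_two hgx.le) (hyc j hj)
    have h2 := mul_pos hneg (hxc j hj)
    simp only [map_add, map_smul, smul_eq_mul]
    linarith

theorem isBounded_nonneg_of_nonpos (hp : ¬ IsRealizable f (U ∩ {x | 0 < g x}) s σ)
    (hm : IsRealizable f (U ∩ {x | g x < 0}) s σ)
    (h : IsBounded f (U ∩ {x | g x ≤ 0}) s i σ) : IsBounded f (U ∩ {x | 0 ≤ g x}) s i σ := by
  have := isBounded_nonpos_of_nonneg (f := f) (U := U) (s := s) (σ := σ) (g := -g) (i := i)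
  simp only [LinearMap.neg_apply, Left.neg_pos_iff, Left.neg_neg_iff, Left.neg_nonpos_iff,
    Left.nonneg_neg_iff] at this
  exact this hm hp h

/-- The signs coded by a set of indices. -/
noncomputable def sgn (P : Finset ι) (j : ι) : ℝ := by
  classical exact if j ∈ P then 1 else -1

theorem sgn_ne_zero (P : Finset ι) (j : ι) : sgn P j ≠ 0 := by
  unfold sgn; split_ifs <;> norm_num

/-! ### Counting bounded cells by deletion and contraction -/

variable (f)

open Classical in
/-- The number of bounded cells of the functionals in `s` on `U`, relative to the functional `i`. -/
noncomputable def numBounded (U : Submodule ℝ E) (s : Finset ι) (i : ι) : ℕ :=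
  ∑ P ∈ s.powerset, if IsRealizable f U s (sgn P) ∧ IsBounded f U s i (sgn P) then 1 else 0

variable {f}

theorem numBounded_eq_zero
    (h : ∀ P, IsRealizable f U s (sgn P) → ¬ IsBounded f U s i (sgn P)) :
    numBounded f U s i = 0 := by
  unfold numBounded
  refine Finset.sum_eq_zero fun P _ => if_neg fun hP => h P hP.1 hP.2

theorem numBounded_eq_zero_of_loop {k : ι} (hk : k ∈ s) (h : ∀ x ∈ U, f k x = 0) :
    numBounded f U s i = 0 := by
  refine numBounded_eq_zero ?_
  rintro P ⟨x, hx, hP⟩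
  have := hP k hk
  simp [h x hx] at this

/-- One of `y`, `-y` lies in any given closed cell; there the functional `i` vanishes and `k` does
not, so no cell is bounded. -/
theorem numBounded_eq_zero_of_coloop [DecidableEq ι] {k : ι} (hk : k ∈ s) (his : i ∈ s)
    (hik : i ≠ k) {y : E} (hy : y ∈ U) (hys : ∀ j ∈ s.erase k, f j y = 0) (hyk : f k y ≠ 0) :
    numBounded f U s i = 0 := by
  refine numBounded_eq_zero fun P _ hB => ?_
  have key : ∀ z ∈ U, (∀ j ∈ s.erase k, f j z = 0) → 0 ≤ sgn P k * f k z → f k z = 0 := by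
    intro z hz hzs hzk
    refine hB z hz (fun j hj => ?_) (hzs i (by simp [his, hik])) k hk
    by_cases hjk : j = k
    · rwa [hjk]
    · rw [hzs j (by simp [hj, hjk]), mul_zero]
  rcases le_total 0 (sgn P k * f k y) with h | h
  · exact hyk (key y hy hys h)
  · apply hyk
    have := key (-y) (U.neg_mem hy) (fun j hj => by simp [hys j hj]) (by simpa using h)
    simpa using this

/-- Deletion-contraction, checked separately for each sign pattern of `s`. If the kernel of `f k`
cuts the cell, the two pieces contribute as many bounded cells as the whole cell and its slice
together, one being bounded as the conjunction and the other as the disjunction of the pieces. If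
the cell lies on one side, that piece is bounded exactly when the whole cell is. -/
theorem numBounded_insert [DecidableEq ι] {k : ι} (hk : k ∉ s)
    (hg : ∃ x ∈ U, f k x ≠ 0) (hco : ∀ y ∈ U, (∀ j ∈ s, f j y = 0) → f k y = 0) :
    numBounded f U (insert k s) i =
      numBounded f U s i + numBounded f (U ⊓ LinearMap.ker (f k)) s i := by
  classical
  unfold numBounded
  rw [Finset.sum_powerset_insert hk, ← Finset.sum_add_distrib, ← Finset.sum_add_distrib]
  refine Finset.sum_congr rfl fun P hP => ?_
  rw [Finset.mem_powerset] at hP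
  have hkP : k ∉ P := fun h => hk (hP h)
  have hs : ∀ j ∈ s, sgn (insert k P) j = sgn P j := by
    intro j hj
    have : j ≠ k := by rintro rfl; exact hk hj
    simp [sgn, this]
  have hk1 : sgn (insert k P) k = 1 := by simp [sgn]
  have hk2 : sgn P k = -1 := by simp [sgn, hkP]
  have e1 : IsRealizable f U (insert k s) (sgn P) ↔
      IsRealizable f (U ∩ {x | f k x < 0}) s (sgn P) := by
    simp only [IsRealizable, Finset.forall_mem_insert, hk2, Set.mem_inter_iff, Set.mem_ofPred_eq,
      neg_mul, one_mul, Left.neg_pos_iff, and_assoc]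
  have e2 : IsRealizable f U (insert k s) (sgn (insert k P)) ↔
      IsRealizable f (U ∩ {x | 0 < f k x}) s (sgn P) := by
    simp +contextual only [IsRealizable, Finset.forall_mem_insert, hk1, Set.mem_inter_iff,
      Set.mem_ofPred_eq, one_mul, and_assoc, hs]
  have e3 : IsBounded f U (insert k s) i (sgn P) ↔
      IsBounded f (U ∩ {x | f k x ≤ 0}) s i (sgn P) := by
    simp only [IsBounded, Finset.forall_mem_insert, hk2, Set.mem_inter_iff, Set.mem_ofPred_eq,
      neg_mul, one_mul, Left.nonneg_neg_iff]
    exact ⟨fun h y hy hc h0 => (h y hy.1 ⟨hy.2, hc⟩ h0).2, fun h y hy hc h0 =>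
      have := h y ⟨hy, hc.1⟩ hc.2 h0
      ⟨hco y hy this, this⟩⟩
  have e4 : IsBounded f U (insert k s) i (sgn (insert k P)) ↔
      IsBounded f (U ∩ {x | 0 ≤ f k x}) s i (sgn P) := by
    simp +contextual only [IsBounded, Finset.forall_mem_insert, hk1, Set.mem_inter_iff,
      Set.mem_ofPred_eq, one_mul, hs]
    exact ⟨fun h y hy hc h0 => (h y hy.1 ⟨hy.2, hc⟩ h0).2, fun h y hy hc h0 =>
      have := h y ⟨hy, hc.1⟩ hc.2 h0
      ⟨hco y hy this, this⟩⟩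
  rw [e1, e2, e3, e4, isRealizable_iff_or hg, isRealizable_ker_iff_and hg,
    isBounded_iff_and (g := f k), isBounded_ker_iff_or fun j _ => sgn_ne_zero P j]
  have h1 := isBounded_nonpos_of_nonneg (f := f) (U := U) (s := s) (σ := sgn P) (g := f k) (i := i)
  have h2 := isBounded_nonneg_of_nonpos (f := f) (U := U) (s := s) (σ := sgn P) (g := f k) (i := i)
  by_cases a1 : IsRealizable f (U ∩ {x | 0 < f k x}) s (sgn P) <;>
  by_cases a2 : IsRealizable f (U ∩ {x | f k x < 0}) s (sgn P) <;>
  by_cases b1 : IsBounded f (U ∩ {x | 0 ≤ f k x}) s i (sgn P) <;>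
  by_cases b2 : IsBounded f (U ∩ {x | f k x ≤ 0}) s i (sgn P) <;>
  simp_all

/-- The number of bounded cells relative to a functional of the family does not depend on this
functional. -/
theorem numBounded_eq (U : Submodule ℝ E) (s : Finset ι) {i i' : ι} (hi : i ∈ s) (hi' : i' ∈ s) :
    numBounded f U s i = numBounded f U s i' := by
  classical
  induction s using Finset.strongInduction generalizing U with
  | _ s ih =>
  rcases eq_or_ne i i' with rfl | hne
  · rfl
  by_cases hk : ∃ k ∈ s, k ≠ i ∧ k ≠ i'
  · obtain ⟨k, hk, hki, hki'⟩ := hk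
    by_cases hloop : ∀ x ∈ U, f k x = 0
    · rw [numBounded_eq_zero_of_loop hk hloop, numBounded_eq_zero_of_loop hk hloop]
    push Not at hloop
    by_cases hco : ∀ y ∈ U, (∀ j ∈ s.erase k, f j y = 0) → f k y = 0
    · have h1 : i ∈ s.erase k := by simp [hi, hki.symm]
      have h2 : i' ∈ s.erase k := by simp [hi', hki'.symm]
      rw [← Finset.insert_erase hk, numBounded_insert (by simp) hloop hco,
        numBounded_insert (by simp) hloop hco, ih _ (Finset.erase_ssubset hk) U h1 h2,
        ih _ (Finset.erase_ssubset hk) _ h1 h2]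
    · push Not at hco
      obtain ⟨y, hy, hys, hyk⟩ := hco
      rw [numBounded_eq_zero_of_coloop hk hi hki.symm hy hys hyk,
        numBounded_eq_zero_of_coloop hk hi' hki'.symm hy hys hyk]
  · push Not at hk
    have hs : s = {i, i'} := by
      ext j
      simp only [Finset.mem_insert, Finset.mem_singleton]
      refine ⟨fun hj => ?_, ?_⟩
      · by_contra! hcon
        exact hcon.2 (hk j hj hcon.1)
      · rintro (rfl | rfl) <;> assumption
    by_cases hloop : ∀ x ∈ U, f i x = 0
    · rw [numBounded_eq_zero_of_loop hi hloop, numBounded_eq_zero_of_loop hi hloop]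
    by_cases hloop' : ∀ x ∈ U, f i' x = 0
    · rw [numBounded_eq_zero_of_loop hi' hloop', numBounded_eq_zero_of_loop hi' hloop']
    push Not at hloop hloop'
    -- If `b` is nonzero somewhere on the kernel of `a`, each of the two functionals is a coloop;
    -- for `a`, the witness is the combination of `x` and `y` killed by `f b`.
    have key : ∀ a b, a ∈ s → b ∈ s → a ≠ b → s = {a, b} → (∃ x ∈ U, f a x ≠ 0) →
        ∀ y ∈ U, f a y = 0 → f b y ≠ 0 → numBounded f U s a = 0 ∧ numBounded f U s b = 0 := by
      rintro a b ha hb hab hs ⟨x, hx, hax⟩ y hy hay hby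
      constructor
      · refine numBounded_eq_zero_of_coloop hb ha hab hy ?_ hby
        rw [hs]
        intro j hj
        simp only [Finset.mem_erase, Finset.mem_insert, Finset.mem_singleton] at hj
        rcases hj.2 with h | h
        · rwa [h]
        · exact absurd h hj.1
      · refine numBounded_eq_zero_of_coloop ha hb hab.symm
          (y := f b y • x - f b x • y) (U.sub_mem (U.smul_mem _ hx) (U.smul_mem _ hy)) ?_ ?_
        · rw [hs]
          intro j hj
          simp only [Finset.mem_erase, Finset.mem_insert, Finset.mem_singleton] at hj
          rcases hj.2 with h | h
          · exact absurd h hj.1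
          · rw [h, map_sub, map_smul, map_smul, smul_eq_mul, smul_eq_mul]
            ring
        · rw [map_sub, map_smul, map_smul, hay, smul_zero, sub_zero, smul_eq_mul]
          exact mul_ne_zero hby hax
    by_cases h1 : ∀ y ∈ U, f i y = 0 → f i' y = 0
    · by_cases h2 : ∀ y ∈ U, f i' y = 0 → f i y = 0
      · unfold numBounded
        refine Finset.sum_congr rfl fun P _ => ?_
        have e : IsBounded f U s i (sgn P) ↔ IsBounded f U s i' (sgn P) := by
          unfold IsBounded
          exact ⟨fun h y hy hc h0 => h y hy hc (h2 y hy h0),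
            fun h y hy hc h0 => h y hy hc (h1 y hy h0)⟩
        rw [e]
      · push Not at h2
        obtain ⟨y, hy, ha, hb⟩ := h2
        have := key i' i hi' hi hne.symm (by rw [hs, Finset.pair_comm]) hloop' y hy ha hb
        rw [this.1, this.2]
    · push Not at h1
      obtain ⟨y, hy, ha, hb⟩ := h1
      have := key i i' hi hi' hne hs hloop y hy ha hb
      rw [this.1, this.2]

end LinearCells

namespace CoxeterSystem

namespace Realization

variable {B W V : Type*} [Group W] {M : CoxeterMatrix B} {cs : CoxeterSystem M W}
  [NormedAddCommGroup V] [InnerProductSpace ℝ V] (R : cs.Realization V)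
  [FiniteDimensional ℝ V]

/-! ### Faces of the fundamental chamber and parabolic subgroups -/

theorem inner_eq_sum [Fintype B] (z : V) {x : V}
    (hx : x ∈ Submodule.span ℝ (Set.range R.root)) :
    inner ℝ z x = ∑ i, inner ℝ (R.coweight i) x * inner ℝ z (R.root i) := by
  conv_lhs => rw [R.eq_sum_coweight hx]
  rw [inner_sum]
  simp only [inner_smul_right]

theorem mul_inner_root_nonneg {z x : V}
    (hz : ∀ i, inner ℝ (R.coweight i) x ≠ 0 → 0 ≤ inner ℝ z (R.root i)) (hn : R.IsNonneg x)
    (i : B) : 0 ≤ inner ℝ (R.coweight i) x * inner ℝ z (R.root i) := by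
  by_cases hi : inner ℝ (R.coweight i) x = 0
  · rw [hi, zero_mul]
  · exact mul_nonneg (hn i) (hz i hi)

theorem inner_nonneg_of_isNonneg [Finite B] {z x : V}
    (hz : ∀ i, inner ℝ (R.coweight i) x ≠ 0 → 0 ≤ inner ℝ z (R.root i))
    (hx : x ∈ Submodule.span ℝ (Set.range R.root)) (hn : R.IsNonneg x) : 0 ≤ inner ℝ z x := by
  cases nonempty_fintype B
  rw [R.inner_eq_sum z hx]
  exact Finset.sum_nonneg fun i _ => R.mul_inner_root_nonneg hz hn i

/-- A sum of nonnegative terms vanishes only termwise; thus a positive root cuts the closed chamber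
in a face. -/
theorem inner_eq_zero_iff_of_isNonneg [Finite B] {z x : V}
    (hz : ∀ i, inner ℝ (R.coweight i) x ≠ 0 → 0 ≤ inner ℝ z (R.root i))
    (hx : x ∈ Submodule.span ℝ (Set.range R.root)) (hn : R.IsNonneg x) :
    inner ℝ z x = 0 ↔ ∀ k, inner ℝ (R.coweight k) x ≠ 0 → inner ℝ z (R.root k) = 0 := by
  cases nonempty_fintype B
  rw [R.inner_eq_sum z hx,
    Finset.sum_eq_zero_iff_of_nonneg fun i _ => R.mul_inner_root_nonneg hz hn i]
  simp only [Finset.mem_univ, true_imp_iff, mul_eq_zero, or_iff_not_imp_left, ne_eq]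

open Classical in
/-- A point in the relative interior of the face of the fundamental chamber on which the simple
roots in `K` vanish. -/
noncomputable def facePoint (K : Set B) : V :=
  (R.exists_inner_root_eq fun j => if j ∈ K then 0 else 1).choose

open Classical in
theorem inner_facePoint_root (K : Set B) (j : B) :
    inner ℝ (R.facePoint K) (R.root j) = if j ∈ K then 0 else 1 :=
  (R.exists_inner_root_eq fun j => if j ∈ K then 0 else 1).choose_spec j

theorem inner_facePoint_root_nonneg (K : Set B) (j : B) :
    0 ≤ inner ℝ (R.facePoint K) (R.root j) := by
  rw [R.inner_facePoint_root]; split_ifs <;> norm_num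

theorem inner_facePoint_root_eq_zero_iff {K : Set B} {j : B} :
    inner ℝ (R.facePoint K) (R.root j) = 0 ↔ j ∈ K := by
  rw [R.inner_facePoint_root]; simp

theorem rep_facePoint {K : Set B} {w : W} (hw : w ∈ parabolic (cs.simple '' K)) :
    R.rep w (R.facePoint K) = R.facePoint K :=
  R.rep_eq_self_of_mem_parabolic hw fun i hi => by
    rw [real_inner_comm]; exact R.inner_facePoint_root_eq_zero_iff.mpr hi

variable [Finite B]

/-- Let `p` be the face point. Since `-w α_i` is nonnegative, `⟨p, w α_i⟩ ≤ 0`; since `w` fixes `p`,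
this is `⟨p, α_i⟩ ≥ 0`. So it vanishes and `i ∈ K`. -/
theorem mem_of_isRightDescent {K : Set B} {w : W}
    (hw : R.rep w (R.facePoint K) = R.facePoint K) {i : B} (h : cs.IsRightDescent w i) :
    i ∈ K := by
  have hr : R.IsRoot (R.rep w (R.root i)) := ⟨w, i, rfl⟩
  have h1 := R.inner_nonneg_of_isNonneg (fun i _ => R.inner_facePoint_root_nonneg K i)
    hr.neg.mem_span (R.isNonneg_neg_rep h)
  have h2 : R.rep w⁻¹ (R.facePoint K) = R.facePoint K := by
    conv_lhs => rw [← hw, R.rep_inv_rep]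
  rw [inner_neg_right, R.inner_rep_right, h2] at h1
  exact R.inner_facePoint_root_eq_zero_iff.mp
    (le_antisymm (by linarith) (R.inner_facePoint_root_nonneg K i))

theorem mem_of_mem_reduced_word {K : Set B} {ω : List B} (hω : cs.IsReduced ω)
    (hw : R.rep (cs.wordProd ω) (R.facePoint K) = R.facePoint K) : ∀ i ∈ ω, i ∈ K := by
  induction ω using List.reverseRecOn with
  | nil => simp
  | append_singleton ω i ih =>
    have hred : cs.IsReduced ω := by simpa using hω.take ω.length
    have hd : cs.IsRightDescent (cs.wordProd (ω ++ [i])) i := by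
      rw [IsRightDescent, hω, wordProd_append, wordProd_singleton,
        simple_mul_simple_cancel_right, hred]
      simp
    have hi := R.mem_of_isRightDescent hw hd
    have hω' : R.rep (cs.wordProd ω) (R.facePoint K) = R.facePoint K := by
      rw [wordProd_append, wordProd_singleton, R.rep_mul_apply,
        R.rep_facePoint (simple_mem_parabolic hi)] at hw
      exact hw
    intro j hj
    rw [List.mem_append, List.mem_singleton] at hj
    rcases hj with hj | rfl
    · exact ih hred hω' j hj
    · exact hi

/-- The parabolic subgroup is the stabilizer of a generic point of its face: the last letter of a
reduced word of a stabilizing element is a descent, hence lies in `K`, and can be removed. -/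
theorem mem_parabolic_iff {K : Set B} {w : W} :
    w ∈ parabolic (cs.simple '' K) ↔ R.rep w (R.facePoint K) = R.facePoint K := by
  refine ⟨R.rep_facePoint, fun h => ?_⟩
  obtain ⟨ω, hω, rfl⟩ := cs.exists_isReduced w
  exact wordProd_mem_parabolic (R.mem_of_mem_reduced_word hω h)

include R in
theorem support_subset_iff {K : Set B} {w : W} :
    cs.support w ⊆ cs.simple '' K ↔ w ∈ parabolic (cs.simple '' K) := by
  constructor
  · intro h
    obtain ⟨ω, hω, rfl⟩ := cs.exists_isReduced w
    refine wordProd_mem_parabolic fun i hi => ?_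
    obtain ⟨j, hj, hij⟩ := h ⟨ω, hω, rfl, List.mem_map_of_mem hi⟩
    rwa [← R.simple_injective hij]
  · rintro h _ ⟨ω, hω, rfl, hs⟩
    obtain ⟨i, hi, rfl⟩ := List.mem_map.mp hs
    exact ⟨i, R.mem_of_mem_reduced_word hω (R.rep_facePoint h) i hi, rfl⟩

omit [Finite B] in
/-- The simple roots that occur in the positive root of a reflection. -/
def rootSupport (t : W) : Set B := {k | inner ℝ (R.coweight k) (R.posRoot t) ≠ 0}

theorem mem_parabolic_iff_rootSupport_subset {t : W} (ht : cs.IsReflection t) {K : Set B} :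
    t ∈ parabolic (cs.simple '' K) ↔ R.rootSupport t ⊆ K := by
  rw [R.mem_parabolic_iff]
  change R.facePoint K ∈ R.hyperplane t ↔ _
  rw [R.mem_hyperplane_iff ht, real_inner_comm,
    R.inner_eq_zero_iff_of_isNonneg (fun i _ => R.inner_facePoint_root_nonneg K i)
      (R.isRoot_posRoot ht).mem_span (R.isNonneg_posRoot ht)]
  simp only [R.inner_facePoint_root_eq_zero_iff]
  rfl

/-- Both sets are determined by which standard parabolic subgroups contain `t`. -/
theorem support_eq_image_rootSupport {t : W} (ht : cs.IsReflection t) :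
    cs.support t = cs.simple '' R.rootSupport t := by
  have key : ∀ K, cs.support t ⊆ cs.simple '' K ↔ R.rootSupport t ⊆ K := fun K => by
    rw [R.support_subset_iff, R.mem_parabolic_iff_rootSupport_subset ht]
  have h : cs.simple '' (cs.simple ⁻¹' cs.support t) = cs.support t := by
    apply Set.image_preimage_eq_of_subset
    rintro _ ⟨ω, -, -, hs⟩
    obtain ⟨i, -, rfl⟩ := List.mem_map.mp hs
    exact ⟨i, rfl⟩
  apply subset_antisymm
  · exact (key _).mpr subset_rfl
  · rw [Set.image_subset_iff]
    exact (key _).mp h.ge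

theorem posRoot_mem_span_rootSupport {t : W} (ht : cs.IsReflection t) :
    R.posRoot t ∈ Submodule.span ℝ (R.root '' R.rootSupport t) :=
  R.mem_span_of_inner_coweight_eq_zero (R.isRoot_posRoot ht).mem_span fun k hk => by
    simpa [rootSupport] using hk

theorem rootSupport_nonempty {t : W} (ht : cs.IsReflection t) : (R.rootSupport t).Nonempty := by
  by_contra h
  rw [Set.not_nonempty_iff_eq_empty] at h
  have h1 := R.posRoot_mem_span_rootSupport ht
  rw [h, Set.image_empty, Submodule.span_empty, Submodule.mem_bot] at h1
  exact (R.isRoot_posRoot ht).ne_zero h1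

/-! ### Irreducibility -/

theorem simple_commute_iff {i j : B} (hij : i ≠ j) :
    cs.simple i * cs.simple j = cs.simple j * cs.simple i ↔
      inner ℝ (R.root i) (R.root j) = 0 := by
  constructor
  · intro h
    have h1 := congrArg (fun w => inner ℝ (R.coweight i) (R.rep w (R.root j))) h
    simp only [R.rep_mul_apply, R.rep_simple_root] at h1
    simp only [R.rep_simple_apply, inner_sub_right, inner_neg_right, inner_smul_right,
      R.inner_coweight_root, hij, if_true, if_false] at h1
    linarith
  · intro h
    apply R.rep_injective
    ext x
    simp only [R.rep_mul_apply, R.rep_simple_apply, inner_sub_right, inner_smul_right, h,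
      real_inner_comm (R.root i) (R.root j)]
    module

theorem isIrreducible_image_iff {L : Set B} : IsIrreducible (cs.simple '' L) ↔
    L.Nonempty ∧ ∀ K ⊆ L, K.Nonempty → (L \ K).Nonempty →
      ∃ i ∈ K, ∃ j ∈ L \ K, inner ℝ (R.root i) (R.root j) ≠ 0 := by
  rw [IsIrreducible, Set.image_nonempty]
  refine and_congr_right fun _ => ⟨fun h K hK h1 h2 => ?_, fun h K hK h1 h2 => ?_⟩
  · obtain ⟨_, ⟨i, hi, rfl⟩, s, hs, hne⟩ := h (cs.simple '' K) (Set.image_mono hK)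
      (h1.image _) (by rw [← Set.image_sdiff R.simple_injective]; exact h2.image _)
    rw [← Set.image_sdiff R.simple_injective] at hs
    obtain ⟨j, hj, rfl⟩ := hs
    refine ⟨i, hi, j, hj, fun h0 => hne ((R.simple_commute_iff ?_).mpr h0)⟩
    rintro rfl
    exact hj.2 hi
  · obtain ⟨K, hKL, rfl⟩ := Set.subset_image_iff.mp hK
    rw [← Set.image_sdiff R.simple_injective] at h2 ⊢
    obtain ⟨i, hi, j, hj, hne⟩ := h K hKL (Set.image_nonempty.mp h1) (Set.image_nonempty.mp h2)
    refine ⟨_, ⟨i, hi, rfl⟩, _, ⟨j, hj, rfl⟩, fun h0 => hne ((R.simple_commute_iff ?_).mp h0)⟩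
    rintro rfl
    exact hj.2 hi

/-- Suppose the support splits orthogonally into `K` and its complement, and let `p` be the
component of the root `α` in the span of `K`. Then `t` preserves that span and `t p = p - 2⟨p,p⟩ α`,
which forces `α` into the span of `K`. -/
theorem isIrreducible_rootSupport {t : W} (ht : cs.IsReflection t) :
    IsIrreducible (cs.simple '' R.rootSupport t) := by
  rw [R.isIrreducible_image_iff]
  refine ⟨R.rootSupport_nonempty ht, fun K hK h1 h2 => ?_⟩
  by_contra! hcon
  set L := R.rootSupport t with hL
  have hstab : ∀ x ∈ Submodule.span ℝ (R.root '' K),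
      R.rep t x ∈ Submodule.span ℝ (R.root '' K) := by
    intro x hx
    refine parabolic_induction (cs := cs) (K := L) (p := fun w => R.rep w x ∈ _)
      (by simpa using hx) (fun i hi v hv => ?_)
      ((R.mem_parabolic_iff_rootSupport_subset ht).mpr subset_rfl)
    rw [R.rep_mul_apply, R.rep_simple_apply]
    by_cases hiK : i ∈ K
    · exact Submodule.sub_mem _ hv
        (Submodule.smul_mem _ _ (Submodule.subset_span ⟨i, hiK, rfl⟩))
    · have h0 : inner ℝ (R.root i) (R.rep v x) = 0 := by
        have : Submodule.span ℝ (R.root '' K) ≤ (ℝ ∙ R.root i)ᗮ := by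
          rw [Submodule.span_le]
          rintro _ ⟨k, hk, rfl⟩
          rw [SetLike.mem_coe, Submodule.mem_orthogonal_singleton_iff_inner_left]
          exact hcon k hk i ⟨hi, hiK⟩
        exact Submodule.mem_orthogonal_singleton_iff_inner_right.mp (this hv)
      rw [h0]
      simpa using hv
  have hα := R.posRoot_mem_span_rootSupport ht
  rw [← hL, ← Set.union_sdiff_cancel hK, Set.image_union, Submodule.span_union,
    Submodule.mem_sup] at hα
  obtain ⟨p, hp, q, hq, hpq⟩ := hα
  have hq0 : inner ℝ q p = 0 := by
    have hle : Submodule.span ℝ (R.root '' (L \ K)) ≤ (Submodule.span ℝ (R.root '' K))ᗮ := by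
      rw [Submodule.span_le]
      rintro _ ⟨j, hj, rfl⟩
      rw [SetLike.mem_coe, Submodule.mem_orthogonal']
      intro y hy
      have : Submodule.span ℝ (R.root '' K) ≤ (ℝ ∙ R.root j)ᗮ := by
        rw [Submodule.span_le]
        rintro _ ⟨k, hk, rfl⟩
        rw [SetLike.mem_coe, Submodule.mem_orthogonal_singleton_iff_inner_left]
        exact hcon k hk j hj
      exact Submodule.mem_orthogonal_singleton_iff_inner_right.mp (this hy)
    exact (Submodule.mem_orthogonal' _ _).mp (hle hq) p hp
  obtain ⟨k, hk⟩ := h1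
  obtain ⟨j, hj⟩ := h2
  have hp0 : p ≠ 0 := by
    rintro rfl
    rw [zero_add] at hpq
    rw [hpq] at hq
    exact hK hk (R.inner_coweight_eq_zero_of_mem_span hq fun h => h.2 hk)
  have hmem := hstab p hp
  rw [R.rep_reflection_apply ht, ← hpq, inner_add_left, hq0, add_zero, hpq] at hmem
  have h3 : R.posRoot t ∈ Submodule.span ℝ (R.root '' K) := by
    have h4 := Submodule.sub_mem _ hp hmem
    rw [sub_sub_cancel] at h4
    exact (Submodule.smul_mem_iff _ (mul_ne_zero two_ne_zero (inner_self_ne_zero.mpr hp0))).mp h4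
  exact hj.1 (R.inner_coweight_eq_zero_of_mem_span h3 hj.2)

/-- Choose the conjugate root `β` highest against a point of the fundamental chamber; it is dominant
for `L`. A simple root of `L` outside the support but joined to it would have negative inner product
with `β`, so irreducibility forces full support. -/
theorem exists_conj_rootSupport_eq [Finite W] {L : Set B} (hL : IsIrreducible (cs.simple '' L))
    {r : W} (hr : cs.IsReflection r) (hrL : r ∈ parabolic (cs.simple '' L)) :
    ∃ u ∈ parabolic (cs.simple '' L), R.rootSupport (u⁻¹ * r * u) = L := by
  cases nonempty_fintype B
  obtain ⟨u, hu, hmax⟩ := Set.exists_max_image (parabolic (cs.simple '' L) : Set W)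
    (fun u => inner ℝ (R.facePoint ∅) (R.rep u⁻¹ (R.posRoot r))) (Set.toFinite _)
    ⟨1, one_mem _⟩
  set β := R.rep u⁻¹ (R.posRoot r) with hβ
  have hroot : R.IsRoot β := (R.isRoot_posRoot hr).rep _
  have hspan : β ∈ Submodule.span ℝ (R.root '' L) := by
    refine R.rep_mem_span (inv_mem hu) (Submodule.span_mono (Set.image_mono ?_)
      (R.posRoot_mem_span_rootSupport hr))
    exact (R.mem_parabolic_iff_rootSupport_subset hr).mp hrL
  have hdom : ∀ j ∈ L, 0 ≤ inner ℝ β (R.root j) := by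
    intro j hj
    rw [real_inner_comm]
    have h := hmax (u * cs.simple j) (mul_mem hu (simple_mem_parabolic hj))
    rw [mul_inv_rev, cs.inv_simple, R.rep_mul_apply, ← hβ, R.rep_simple_apply, inner_sub_right,
      inner_smul_right, R.inner_facePoint_root] at h
    simp only [Set.mem_empty_iff_false, if_false] at h
    linarith
  have hnn : R.IsNonneg β := by
    -- A negative dominant `β` would have `⟨β, β⟩ ≤ 0`, by expanding one factor in simple roots.
    refine hroot.isNonneg_or.resolve_right fun hneg => ?_
    have h1 := R.inner_eq_sum β hroot.mem_span
    rw [hroot.inner_self] at h1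
    have h2 : ∑ i, inner ℝ (R.coweight i) β * inner ℝ β (R.root i) ≤ 0 := by
      refine Finset.sum_nonpos fun i _ => ?_
      by_cases hi : i ∈ L
      · have := hneg i
        rw [inner_neg_right] at this
        exact mul_nonpos_of_nonpos_of_nonneg (by linarith) (hdom i hi)
      · rw [R.inner_coweight_eq_zero_of_mem_span hspan hi, zero_mul]
    linarith
  have hpos : R.posRoot (u⁻¹ * r * u) = β := by
    have := R.posRoot_conj_of_isNonneg hr (w := u⁻¹) hnn
    rwa [inv_inv] at this
  refine ⟨u, hu, ?_⟩
  have ht : cs.IsReflection (u⁻¹ * r * u) := by simpa using hr.conj u⁻¹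
  have hsub : R.rootSupport (u⁻¹ * r * u) ⊆ L := by
    intro k hk
    by_contra hkL
    rw [rootSupport, hpos] at hk
    exact hk (R.inner_coweight_eq_zero_of_mem_span hspan hkL)
  refine hsub.antisymm ?_
  by_contra hnot
  obtain ⟨i, hi, j, hj, hij⟩ := (R.isIrreducible_image_iff.mp hL).2 _ hsub
    (R.rootSupport_nonempty ht) (Set.sdiff_nonempty.mpr hnot)
  have hne : i ≠ j := by rintro rfl; exact hj.2 hi
  have h1 := hdom j hj.1
  rw [real_inner_comm, R.inner_eq_sum (R.root j) hroot.mem_span] at h1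
  have h2 : ∑ k, inner ℝ (R.coweight k) β * inner ℝ (R.root j) (R.root k) < 0 := by
    refine Finset.sum_neg' (fun k _ => ?_) ⟨i, Finset.mem_univ _, ?_⟩
    · by_cases hk : k = j
      · have h3 : inner ℝ (R.coweight j) β = 0 := by
          have := hj.2
          rw [rootSupport, hpos] at this
          simpa using this
        rw [hk, h3, zero_mul]
      · exact mul_nonpos_of_nonneg_of_nonpos (hnn k) (R.inner_root_nonpos (Ne.symm hk))
    · rw [rootSupport, hpos] at hi
      refine mul_neg_of_pos_of_neg ((hnn i).lt_of_ne' hi) ?_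
      refine lt_of_le_of_ne (R.inner_root_nonpos hne.symm) ?_
      rwa [real_inner_comm]
  linarith

/-! ### Palindromic reduced expressions of reflections -/

omit [Finite B] in
theorem not_isNonneg_of_lt {x : V} {k : B} (h : inner ℝ (R.coweight k) x < 0) :
    ¬ R.IsNonneg x := fun hx => (hx k).not_gt h

include R in
-- Conjugating by a simple reflection whose root has positive inner product with the root of `t`
-- lowers the length by 2, unless `t` is that simple reflection.
theorem exists_isReducedConj {t : W} (ht : cs.IsReflection t) :
    ∃ s v : W, cs.IsReducedConj t s v := by
  cases nonempty_fintype B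
  induction hn : cs.length t using Nat.strong_induction_on generalizing t with
  | _ n ih =>
  subst hn
  have hroot := R.isRoot_posRoot ht
  have hnn := R.isNonneg_posRoot ht
  -- These products sum to the squared norm 1 of the root, so one of them is positive.
  obtain ⟨i, hi⟩ : ∃ i, 0 < inner ℝ (R.coweight i) (R.posRoot t) *
      inner ℝ (R.posRoot t) (R.root i) := by
    by_contra! hcon
    have h1 := R.inner_eq_sum (R.posRoot t) hroot.mem_span
    rw [hroot.inner_self] at h1
    have := Finset.sum_nonpos fun i (_ : i ∈ Finset.univ) => hcon i
    linarith
  have hc : 0 < inner ℝ (R.posRoot t) (R.root i) := by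
    by_contra! hcon
    linarith [mul_nonpos_of_nonneg_of_nonpos (hnn i) hcon]
  by_cases hti : t = cs.simple i
  · exact ⟨cs.simple i, 1, ⟨i, rfl⟩, by simp [hti], by simp [hti]⟩
  obtain ⟨k, hki, hk⟩ : ∃ k, k ≠ i ∧ 0 < inner ℝ (R.coweight k) (R.posRoot t) := by
    by_contra! hcon
    have hmem : t ∈ parabolic (cs.simple '' {i}) := by
      rw [R.mem_parabolic_iff_rootSupport_subset ht]
      intro k hk
      by_contra hki
      exact hk (le_antisymm (hcon k hki) (hnn k))
    have hmem' : R.posRoot t ∈ Submodule.span ℝ (R.root '' {i}) :=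
      Submodule.span_mono (Set.image_mono
        ((R.mem_parabolic_iff_rootSupport_subset ht).mp hmem)) (R.posRoot_mem_span_rootSupport ht)
    rw [Set.image_singleton, Submodule.mem_span_singleton] at hmem'
    obtain ⟨a, ha⟩ := hmem'
    apply hti
    apply R.eq_of_posRoot_eq ht (cs.isReflection_simple i)
    rw [R.posRoot_simple]
    symm
    apply R.eq_posRoot ht (R.isRoot_root i) (R.isNonneg_root i)
    have ha0 : a ≠ 0 := by
      rintro rfl
      rw [zero_smul] at ha
      exact hroot.ne_zero ha.symm
    have h2 := R.rep_posRoot_self ht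
    rw [← ha, map_smul, ← smul_neg] at h2
    exact smul_right_injective V ha0 h2
  -- The coefficient of `k` in `t α_i`, and likewise in `s_i t α_i`, is a negative multiple of that
  -- in the root of `t`; so both images are negative roots.
  have hd1 : cs.IsRightDescent t i := by
    by_contra hcon
    refine R.not_isNonneg_of_lt (k := k) ?_ (R.isNonneg_rep hcon)
    rw [R.rep_reflection_apply ht, inner_sub_right, inner_smul_right, R.inner_coweight_root,
      if_neg hki]
    nlinarith [mul_pos hc hk]
  have hd2 : cs.IsRightDescent (cs.simple i * t) i := by
    by_contra hcon
    refine R.not_isNonneg_of_lt (k := k) ?_ (R.isNonneg_rep hcon)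
    rw [R.rep_mul_apply, R.rep_reflection_apply ht, map_sub, map_smul, R.rep_simple_root,
      R.rep_simple_apply]
    simp only [inner_sub_right, inner_smul_right, inner_neg_right, R.inner_coweight_root, hki,
      if_false]
    nlinarith [mul_pos hc hk]
  have hl1 : cs.length (cs.simple i * t) = cs.length (t * cs.simple i) := by
    rw [← cs.length_inv, mul_inv_rev, cs.inv_simple, ht.inv]
  have h1 := cs.isRightDescent_iff.mp hd1
  have h2 := cs.isRightDescent_iff.mp hd2
  have ht' : cs.IsReflection (cs.simple i * t * cs.simple i) := by
    simpa using ht.conj (cs.simple i)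
  obtain ⟨s, v, hs, hv, hl⟩ := ih _ (by omega) ht' rfl
  have htv : t = (v * cs.simple i)⁻¹ * s * (v * cs.simple i) := by
    calc t = cs.simple i * (cs.simple i * t * cs.simple i) * cs.simple i := by
          simp [mul_assoc]
      _ = _ := by rw [hv, mul_inv_rev, cs.inv_simple]; simp only [mul_assoc]
  refine ⟨s, v * cs.simple i, hs, htv, ?_⟩
  have h3 := cs.length_mul_le v (cs.simple i)
  rw [cs.length_simple] at h3
  have h4 := cs.length_mul_le ((v * cs.simple i)⁻¹ * s) (v * cs.simple i)
  rw [← htv] at h4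
  have h5 := cs.length_mul_le (v * cs.simple i)⁻¹ s
  obtain ⟨j, rfl⟩ := hs
  rw [cs.length_simple, cs.length_inv] at h5
  omega

include R in
-- A reduced word of `v`, its reverse and `s` form a reduced word of `t`, so all the letters lie in
-- the support.
theorem mem_parabolic_of_isReducedConj {t s v : W} (h : cs.IsReducedConj t s v) {K : Set B}
    (hsupp : cs.support t = cs.simple '' K) :
    s ∈ cs.simple '' K ∧ v ∈ parabolic (cs.simple '' K) := by
  obtain ⟨⟨i, rfl⟩, htv, hl⟩ := h
  obtain ⟨ω, hω, rfl⟩ := cs.exists_isReduced v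
  have hprod : cs.wordProd (ω.reverse ++ i :: ω) = t := by
    rw [wordProd_append, wordProd_cons, wordProd_reverse, htv, mul_assoc]
  have hred : cs.IsReduced (ω.reverse ++ i :: ω) := by
    rw [IsReduced, hprod, hl, hω.eq]
    simp only [List.length_append, List.length_reverse, List.length_cons]
    omega
  have hmem : ∀ j ∈ ω.reverse ++ i :: ω, j ∈ K := by
    intro j hj
    have : cs.simple j ∈ cs.simple '' K := by
      rw [← hsupp]
      exact ⟨_, hred, hprod, List.mem_map_of_mem hj⟩
    exact (R.simple_injective.mem_set_image).mp this
  exact ⟨⟨i, hmem i (by simp), rfl⟩,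
    wordProd_mem_parabolic fun j hj => hmem j (by simp [hj])⟩

end Realization
end CoxeterSystem

namespace CoxeterSystem

namespace Realization

variable {B W V : Type*} [Group W] {M : CoxeterMatrix B} {cs : CoxeterSystem M W}
  [NormedAddCommGroup V] [InnerProductSpace ℝ V] (R : cs.Realization V)

/-! ### Minimal coset representatives -/

/-- The common orthogonal complement of the simple roots in `K`. -/
def simpleFlat (K : Set B) : Set V := {x | ∀ k ∈ K, inner ℝ (R.root k) x = 0}

variable [FiniteDimensional ℝ V] [Finite B]

omit [Finite B] in
theorem mem_span_iff_forall_mem_simpleFlat {K : Set B} {x : V} :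
    x ∈ Submodule.span ℝ (R.root '' K) ↔ ∀ y ∈ R.simpleFlat K, inner ℝ x y = 0 := by
  rw [← Submodule.orthogonal_orthogonal (Submodule.span ℝ (R.root '' K)),
    Submodule.mem_orthogonal']
  refine forall_congr' fun y => imp_congr_left ?_
  rw [Submodule.mem_orthogonal]
  constructor
  · exact fun h k hk => h _ (Submodule.subset_span ⟨k, hk, rfl⟩)
  · intro h u hu
    induction hu using Submodule.span_induction with
    | mem z hz => obtain ⟨k, hk, rfl⟩ := hz; exact h k hk
    | zero => simp
    | add a b _ _ ha hb => rw [inner_add_left, ha, hb, add_zero]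
    | smul a b _ hb => rw [inner_smul_left, hb, mul_zero]

theorem isNonneg_rep_of_mem_span {K : Set B} {g : W}
    (hg : ∀ k ∈ K, R.IsNonneg (R.rep g (R.root k))) {x : V}
    (hx : x ∈ Submodule.span ℝ (R.root '' K)) (hn : R.IsNonneg x) : R.IsNonneg (R.rep g x) := by
  cases nonempty_fintype B
  intro i
  rw [R.eq_sum_coweight (Submodule.span_mono (Set.image_subset_range _ _) hx), map_sum, inner_sum]
  refine Finset.sum_nonneg fun k _ => ?_
  rw [map_smul, inner_smul_right]
  by_cases hk : k ∈ K
  · exact mul_nonneg (hn k) (hg k hk i)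
  · rw [R.inner_coweight_eq_zero_of_mem_span hx hk, zero_mul]

theorem isNonneg_rep_inv_of_mem_minCosetReps {K : Set B} {d : W}
    (hd : d ∈ cs.minCosetReps (cs.simple '' K)) {k : B} (hk : k ∈ K) :
    R.IsNonneg (R.rep d⁻¹ (R.root k)) := by
  rw [R.isNonneg_rep_iff, isRightDescent_inv_iff, IsLeftDescent, not_lt]
  exact hd _ (simple_mem_parabolic hk)

/-- If `u⁻¹` had a descent `i`, necessarily in `K`, then `-u⁻¹ α_i` would be nonnegative in the span
of `K`, and `x⁻¹` would keep it nonnegative. This gives uniqueness of minimal coset representatives.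
-/
theorem eq_one_of_isNonneg_rep_inv {K : Set B} {u x : W} (hu : u ∈ parabolic (cs.simple '' K))
    (hx : ∀ k ∈ K, R.IsNonneg (R.rep x⁻¹ (R.root k)))
    (hux : ∀ k ∈ K, R.IsNonneg (R.rep (u * x)⁻¹ (R.root k))) : u = 1 := by
  by_contra hne
  obtain ⟨i, hi⟩ := cs.exists_rightDescent_of_ne_one (inv_ne_one.mpr hne)
  have hiK := R.mem_of_isRightDescent (R.rep_facePoint (inv_mem hu)) hi
  have h1 := R.isNonneg_rep_of_mem_span hx (Submodule.neg_mem _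
    (R.rep_mem_span (inv_mem hu) (Submodule.subset_span ⟨i, hiK, rfl⟩))) (R.isNonneg_neg_rep hi)
  rw [map_neg, ← R.rep_mul_apply, ← mul_inv_rev] at h1
  exact ((R.isRoot_root i).rep _).not_isNonneg_neg (hux i hiK) h1

omit [FiniteDimensional ℝ V] [Finite B] in
theorem exists_mul_mem_minCosetReps (cs : CoxeterSystem M W) (K : Set W) (y : W) :
    ∃ u ∈ parabolic K, ∃ d ∈ cs.minCosetReps K, y = u * d := by
  classical
  have hex : ∃ n, ∃ u ∈ parabolic K, cs.length (u * y) = n := ⟨_, 1, one_mem _, rfl⟩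
  obtain ⟨u, hu, hlen⟩ := Nat.find_spec hex
  refine ⟨u⁻¹, inv_mem hu, u * y, fun v hv => ?_, by simp⟩
  rw [hlen, ← mul_assoc]
  exact Nat.find_min' hex ⟨v * u, mul_mem hv hu, rfl⟩

theorem mem_minCosetReps_iff {K : Set B} {d : W} :
    d ∈ cs.minCosetReps (cs.simple '' K) ↔ ∀ k ∈ K, R.IsNonneg (R.rep d⁻¹ (R.root k)) := by
  refine ⟨fun hd k hk => R.isNonneg_rep_inv_of_mem_minCosetReps hd hk, fun h => ?_⟩
  obtain ⟨u, hu, x, hx, rfl⟩ := exists_mul_mem_minCosetReps cs (cs.simple '' K) d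
  have := R.eq_one_of_isNonneg_rep_inv hu
    (fun k hk => R.isNonneg_rep_inv_of_mem_minCosetReps hx hk) h
  rwa [this, one_mul]

include R in
theorem mul_minCosetReps_injective {K : Set B} {u u' d d' : W}
    (hu : u ∈ parabolic (cs.simple '' K)) (hu' : u' ∈ parabolic (cs.simple '' K))
    (hd : d ∈ cs.minCosetReps (cs.simple '' K)) (hd' : d' ∈ cs.minCosetReps (cs.simple '' K))
    (h : u * d = u' * d') : u = u' ∧ d = d' := by
  have h1 : d = u⁻¹ * u' * d' := by rw [mul_assoc, ← h, inv_mul_cancel_left]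
  have h2 : u⁻¹ * u' = 1 := R.eq_one_of_isNonneg_rep_inv (mul_mem (inv_mem hu) hu')
    (R.mem_minCosetReps_iff.mp hd') (by rw [← h1]; exact R.mem_minCosetReps_iff.mp hd)
  exact ⟨inv_mul_eq_one.mp h2, by rw [h1, h2, one_mul]⟩

/-! ### Elements carrying simple roots to simple roots -/

/-- Simple roots are indecomposable: applying `g⁻¹` to the expansion of `g α_j` writes `α_j` as a
sum of nonnegative vectors, so each that occurs is a multiple of `α_j`, and a unit one. -/
theorem exists_rep_root_eq_of_isNonneg {J K : Set B} {g : W}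
    (hJ : ∀ j ∈ J, R.IsNonneg (R.rep g (R.root j)) ∧
      R.rep g (R.root j) ∈ Submodule.span ℝ (R.root '' K))
    (hK : ∀ k ∈ K, R.IsNonneg (R.rep g⁻¹ (R.root k)))
    {j : B} (hj : j ∈ J) : ∃ k ∈ K, R.rep g (R.root j) = R.root k := by
  cases nonempty_fintype B
  obtain ⟨hn, hspan⟩ := hJ j hj
  have hroot : R.IsRoot (R.rep g (R.root j)) := ⟨g, j, rfl⟩
  set x := R.rep g (R.root j) with hx
  obtain ⟨k, hk⟩ : ∃ k, inner ℝ (R.coweight k) x ≠ 0 := by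
    by_contra! hcon
    apply hroot.ne_zero
    rw [R.eq_sum_coweight hroot.mem_span]
    exact Finset.sum_eq_zero fun i _ => by rw [hcon i, zero_smul]
  have hkK : k ∈ K := by
    by_contra h
    exact hk (R.inner_coweight_eq_zero_of_mem_span hspan h)
  refine ⟨k, hkK, ?_⟩
  have hsum : R.root j = ∑ l, inner ℝ (R.coweight l) x • R.rep g⁻¹ (R.root l) := by
    conv_lhs => rw [← R.rep_inv_rep g (R.root j), ← hx, R.eq_sum_coweight hroot.mem_span]
    rw [map_sum]
    exact Finset.sum_congr rfl fun l _ => map_smul _ _ _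
  have hzero : ∀ i, i ≠ j → inner ℝ (R.coweight i) (R.rep g⁻¹ (R.root k)) = 0 := by
    intro i hij
    have h1 := congrArg (inner ℝ (R.coweight i)) hsum
    rw [R.inner_coweight_root, if_neg hij, inner_sum] at h1
    simp only [inner_smul_right] at h1
    have h2 := (Finset.sum_eq_zero_iff_of_nonneg (fun l _ => ?_)).mp h1.symm k (Finset.mem_univ k)
    · exact (mul_eq_zero.mp h2).resolve_left hk
    · by_cases hl : l ∈ K
      · exact mul_nonneg (hn l) (hK l hl i)
      · rw [R.inner_coweight_eq_zero_of_mem_span hspan hl, zero_mul]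
  have hroot' : R.IsRoot (R.rep g⁻¹ (R.root k)) := ⟨g⁻¹, k, rfl⟩
  have hmem := R.mem_span_of_inner_coweight_eq_zero (K := {j}) hroot'.mem_span
    fun i hi => hzero i hi
  rw [Set.image_singleton, Submodule.mem_span_singleton] at hmem
  obtain ⟨a, ha⟩ := hmem
  have h3 := hroot'.inner_self
  have h4 := hK k hkK j
  rw [← ha, inner_smul_left, inner_smul_right, R.inner_root_self] at h3
  rw [← ha, inner_smul_right, R.inner_coweight_root, if_pos rfl, mul_one] at h4
  simp only [conj_trivial, mul_one] at h3
  have h5 : a = 1 := by nlinarith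
  rw [h5, one_smul] at ha
  rw [hx, ha, R.rep_rep_inv]

theorem conj_simple_eq_iff {d : W} {j k : B} (h : R.IsNonneg (R.rep d⁻¹ (R.root j))) :
    d⁻¹ * cs.simple j * d = cs.simple k ↔ R.rep d⁻¹ (R.root j) = R.root k := by
  have h1 : R.posRoot (d⁻¹ * cs.simple j * d) = R.rep d⁻¹ (R.root j) := by
    have := R.posRoot_conj_of_isNonneg (cs.isReflection_simple j) (w := d⁻¹)
      (by rwa [R.posRoot_simple])
    rwa [inv_inv, R.posRoot_simple] at this
  rw [← h1, ← R.posRoot_simple k]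
  have h2 : cs.IsReflection (d⁻¹ * cs.simple j * d) := by
    simpa using (cs.isReflection_simple j).conj d⁻¹
  exact ⟨fun h => by rw [h], R.eq_of_posRoot_eq h2 (cs.isReflection_simple k)⟩

/-- `d⁻¹` maps the set of simple roots in `J` onto the set of simple roots in `K`. -/
def CarriesRoots (J K : Set B) (d : W) : Prop := R.rep d⁻¹ '' (R.root '' J) = R.root '' K

variable {R}

omit [FiniteDimensional ℝ V] [Finite B] in
theorem CarriesRoots.exists_right {J K : Set B} {d : W} (h : R.CarriesRoots J K d) {j : B}
    (hj : j ∈ J) : ∃ k ∈ K, R.rep d⁻¹ (R.root j) = R.root k := by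
  have : R.rep d⁻¹ (R.root j) ∈ R.root '' K := h ▸ ⟨_, ⟨j, hj, rfl⟩, rfl⟩
  obtain ⟨k, hk, hjk⟩ := this
  exact ⟨k, hk, hjk.symm⟩

omit [FiniteDimensional ℝ V] [Finite B] in
theorem CarriesRoots.exists_left {J K : Set B} {d : W} (h : R.CarriesRoots J K d) {k : B}
    (hk : k ∈ K) : ∃ j ∈ J, R.rep d⁻¹ (R.root j) = R.root k := by
  have : R.root k ∈ R.rep d⁻¹ '' (R.root '' J) := h ▸ ⟨k, hk, rfl⟩
  obtain ⟨_, ⟨j, hj, rfl⟩, hjk⟩ := this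
  exact ⟨j, hj, hjk⟩

omit [FiniteDimensional ℝ V] [Finite B] in
theorem carriesRoots_of {J K : Set B} {d : W}
    (h1 : ∀ j ∈ J, ∃ k ∈ K, R.rep d⁻¹ (R.root j) = R.root k)
    (h2 : ∀ k ∈ K, ∃ j ∈ J, R.rep d⁻¹ (R.root j) = R.root k) : R.CarriesRoots J K d := by
  apply subset_antisymm
  · rintro _ ⟨_, ⟨j, hj, rfl⟩, rfl⟩
    obtain ⟨k, hk, h⟩ := h1 j hj
    exact ⟨k, hk, h.symm⟩
  · rintro _ ⟨k, hk, rfl⟩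
    obtain ⟨j, hj, h⟩ := h2 k hk
    exact ⟨_, ⟨j, hj, rfl⟩, h⟩

theorem CarriesRoots.mem_minCosetReps {J K : Set B} {d : W} (h : R.CarriesRoots J K d) :
    d ∈ cs.minCosetReps (cs.simple '' J) := by
  rw [R.mem_minCosetReps_iff]
  intro j hj
  obtain ⟨k, -, hk⟩ := h.exists_right hj
  rw [hk]
  exact R.isNonneg_root k

theorem carriesRoots_iff {J K : Set B} {d : W} : R.CarriesRoots J K d ↔
    d ∈ cs.minCosetReps (cs.simple '' J) ∧ conjSet (cs.simple '' J) d = cs.simple '' K := by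
  constructor
  · intro h
    refine ⟨h.mem_minCosetReps, ?_⟩
    have hn := R.mem_minCosetReps_iff.mp h.mem_minCosetReps
    apply subset_antisymm
    · rintro _ ⟨_, ⟨j, hj, rfl⟩, rfl⟩
      obtain ⟨k, hk, hjk⟩ := h.exists_right hj
      exact ⟨k, hk, ((R.conj_simple_eq_iff (hn j hj)).mpr hjk).symm⟩
    · rintro _ ⟨k, hk, rfl⟩
      obtain ⟨j, hj, hjk⟩ := h.exists_left hk
      exact ⟨_, ⟨j, hj, rfl⟩, (R.conj_simple_eq_iff (hn j hj)).mpr hjk⟩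
  · rintro ⟨hd, h⟩
    have hn := R.mem_minCosetReps_iff.mp hd
    refine carriesRoots_of (fun j hj => ?_) fun k hk => ?_
    · have : d⁻¹ * cs.simple j * d ∈ cs.simple '' K := h ▸ ⟨_, ⟨j, hj, rfl⟩, rfl⟩
      obtain ⟨k, hk, hjk⟩ := this
      exact ⟨k, hk, (R.conj_simple_eq_iff (hn j hj)).mp hjk.symm⟩
    · have : cs.simple k ∈ conjSet (cs.simple '' J) d := h ▸ ⟨k, hk, rfl⟩
      obtain ⟨_, ⟨j, hj, rfl⟩, hjk⟩ := this
      exact ⟨j, hj, (R.conj_simple_eq_iff (hn j hj)).mp hjk⟩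

omit [FiniteDimensional ℝ V] [Finite B] in
theorem CarriesRoots.inv {J K : Set B} {d : W} (h : R.CarriesRoots J K d) :
    R.CarriesRoots K J d⁻¹ := by
  refine carriesRoots_of (fun k hk => ?_) fun j hj => ?_
  · obtain ⟨j, hj, hjk⟩ := h.exists_left hk
    exact ⟨j, hj, by rw [← hjk, R.rep_inv_rep]⟩
  · obtain ⟨k, hk, hjk⟩ := h.exists_right hj
    exact ⟨k, hk, by rw [← hjk, R.rep_inv_rep]⟩

omit [FiniteDimensional ℝ V] [Finite B] in
theorem CarriesRoots.mul {J K L : Set B} {d e : W} (h : R.CarriesRoots J K d)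
    (h' : R.CarriesRoots K L e) : R.CarriesRoots J L (d * e) := by
  unfold CarriesRoots at *
  rw [← h', ← h]
  simp only [Set.image_image, mul_inv_rev, R.rep_mul_apply]

omit [FiniteDimensional ℝ V] [Finite B] in
theorem CarriesRoots.image_simpleFlat {J K : Set B} {d : W} (h : R.CarriesRoots J K d) :
    R.rep d⁻¹ '' R.simpleFlat J = R.simpleFlat K := by
  apply subset_antisymm
  · rintro _ ⟨x, hx, rfl⟩ k hk
    obtain ⟨j, hj, hjk⟩ := h.exists_left hk
    rw [← hjk, LinearIsometryEquiv.inner_map_map]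
    exact hx j hj
  · intro x hx
    refine ⟨R.rep d x, fun j hj => ?_, R.rep_inv_rep d x⟩
    obtain ⟨k, hk, hjk⟩ := h.exists_right hj
    rw [R.inner_rep_right, hjk]
    exact hx k hk

/-- Equal flats give equal spans of roots. Minimality of `d` makes both `d⁻¹` and `d` preserve
positivity between these spans, so simple roots go to simple roots. -/
theorem carriesRoots_of_image_simpleFlat {J K : Set B} {d : W}
    (hd : d ∈ cs.minCosetReps (cs.simple '' J))
    (h : R.rep d⁻¹ '' R.simpleFlat J = R.simpleFlat K) : R.CarriesRoots J K d := by
  have hn := R.mem_minCosetReps_iff.mp hd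
  have hspan : ∀ j ∈ J, R.rep d⁻¹ (R.root j) ∈ Submodule.span ℝ (R.root '' K) := by
    intro j hj
    rw [R.mem_span_iff_forall_mem_simpleFlat, ← h]
    rintro _ ⟨x, hx, rfl⟩
    rw [LinearIsometryEquiv.inner_map_map]
    exact hx j hj
  have hspan' : ∀ k ∈ K, R.rep d (R.root k) ∈ Submodule.span ℝ (R.root '' J) := by
    intro k hk
    rw [R.mem_span_iff_forall_mem_simpleFlat]
    intro x hx
    rw [R.inner_rep_left]
    have : R.rep d⁻¹ x ∈ R.simpleFlat K := h ▸ ⟨x, hx, rfl⟩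
    exact this k hk
  have hn' : ∀ k ∈ K, R.IsNonneg (R.rep d (R.root k)) := by
    intro k hk
    have hroot : R.IsRoot (R.rep d (R.root k)) := ⟨d, k, rfl⟩
    refine hroot.isNonneg_or.resolve_right fun hneg => ?_
    have h1 := R.isNonneg_rep_of_mem_span hn (Submodule.neg_mem _ (hspan' k hk)) hneg
    rw [map_neg, R.rep_inv_rep] at h1
    exact (R.isRoot_root k).not_isNonneg_neg (R.isNonneg_root k) h1
  refine carriesRoots_of (fun j hj => ?_) fun k hk => ?_
  · exact R.exists_rep_root_eq_of_isNonneg (fun j hj => ⟨hn j hj, hspan j hj⟩)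
      (by rwa [inv_inv]) hj
  · obtain ⟨j, hj, hjk⟩ := R.exists_rep_root_eq_of_isNonneg
      (fun k hk => ⟨hn' k hk, hspan' k hk⟩) hn hk
    exact ⟨j, hj, by rw [← hjk, R.rep_inv_rep]⟩

omit [Finite B] in
theorem CarriesRoots.inner_coweight_rep {J K : Set B} {d : W} (h : R.CarriesRoots J K d)
    {j k : B} (hjk : R.rep d⁻¹ (R.root j) = R.root k) {x : V}
    (hx : x ∈ Submodule.span ℝ (R.root '' J)) :
    inner ℝ (R.coweight k) (R.rep d⁻¹ x) = inner ℝ (R.coweight j) x := by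
  classical
  induction hx using Submodule.span_induction with
  | mem y hy =>
    obtain ⟨i, hi, rfl⟩ := hy
    obtain ⟨l, -, hil⟩ := h.exists_right hi
    rw [hil, R.inner_coweight_root, R.inner_coweight_root]
    refine if_congr ⟨fun hkl => ?_, fun hji => ?_⟩ rfl rfl
    · apply R.root_injective
      apply (R.rep d⁻¹).injective
      rw [hjk, hil, hkl]
    · apply R.root_injective
      rw [← hjk, ← hil, hji]
  | zero => simp
  | add y z _ _ hy hz => rw [map_add, inner_add_right, inner_add_right, hy, hz]
  | smul a y _ hy => rw [map_smul, inner_smul_right, inner_smul_right, hy]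

theorem CarriesRoots.rootSupport_conj_eq_iff {J K : Set B} {d : W} (h : R.CarriesRoots J K d)
    {t : W} (ht : cs.IsReflection t) (htJ : R.rootSupport t ⊆ J) :
    R.rootSupport (d⁻¹ * t * d) = K ↔ R.rootSupport t = J := by
  have hspan : R.posRoot t ∈ Submodule.span ℝ (R.root '' J) :=
    Submodule.span_mono (Set.image_mono htJ) (R.posRoot_mem_span_rootSupport ht)
  have hpos : R.posRoot (d⁻¹ * t * d) = R.rep d⁻¹ (R.posRoot t) := by
    have := R.posRoot_conj_of_isNonneg ht (w := d⁻¹) (R.isNonneg_rep_of_mem_span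
      (R.mem_minCosetReps_iff.mp h.mem_minCosetReps) hspan (R.isNonneg_posRoot ht))
    rwa [inv_inv] at this
  have hsub : R.rootSupport (d⁻¹ * t * d) ⊆ K := by
    intro k hk
    by_contra hkK
    rw [rootSupport, hpos] at hk
    refine hk (R.inner_coweight_eq_zero_of_mem_span (K := K) ?_ hkK)
    rw [R.mem_span_iff_forall_mem_simpleFlat, ← h.image_simpleFlat]
    rintro _ ⟨x, hx, rfl⟩
    rw [LinearIsometryEquiv.inner_map_map]
    exact R.mem_span_iff_forall_mem_simpleFlat.mp hspan x hx
  have hiff : ∀ j k, R.rep d⁻¹ (R.root j) = R.root k →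
      (k ∈ R.rootSupport (d⁻¹ * t * d) ↔ j ∈ R.rootSupport t) := by
    intro j k hjk
    rw [rootSupport, rootSupport, Set.mem_ofPred_eq, Set.mem_ofPred_eq, hpos,
      h.inner_coweight_rep hjk hspan]
  constructor
  · intro hK
    refine htJ.antisymm fun j hj => ?_
    obtain ⟨k, hk, hjk⟩ := h.exists_right hj
    rw [← hiff j k hjk, hK]
    exact hk
  · intro hJ
    refine hsub.antisymm fun k hk => ?_
    obtain ⟨j, hj, hjk⟩ := h.exists_left hk
    rw [hiff j k hjk, hJ]
    exact hj

end Realization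
end CoxeterSystem

namespace CoxeterSystem

namespace Realization

variable {B W V : Type*} [Group W] {M : CoxeterMatrix B} {cs : CoxeterSystem M W}
  [NormedAddCommGroup V] [InnerProductSpace ℝ V] (R : cs.Realization V)

/-! ### Chambers -/

theorem mem_hyperplane_conj {t w : W} {x : V} :
    x ∈ R.hyperplane (w⁻¹ * t * w) ↔ R.rep w x ∈ R.hyperplane t := by
  change R.rep (w⁻¹ * t * w) x = x ↔ R.rep t (R.rep w x) = R.rep w x
  rw [R.rep_mul_apply, R.rep_mul_apply]
  constructor
  · intro h
    conv_rhs => rw [← h, R.rep_rep_inv]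
  · intro h
    rw [h, R.rep_inv_rep]

theorem mem_hyperplane_simple {i : B} {x : V} :
    x ∈ R.hyperplane (cs.simple i) ↔ inner ℝ (R.root i) x = 0 := by
  change R.rep (cs.simple i) x = x ↔ _
  rw [R.rep_simple_apply, sub_eq_self, smul_eq_zero]
  simp [R.root_ne_zero]

theorem mem_compl_iff {x : V} :
    x ∈ (⋃₀ R.arrangement)ᶜ ↔ ∀ w i, inner ℝ (R.rep w (R.root i)) x ≠ 0 := by
  constructor
  · intro h w i h0
    refine h ⟨_, ⟨w * cs.simple i * w⁻¹, ⟨w, i, rfl⟩, rfl⟩, ?_⟩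
    have := R.mem_hyperplane_conj (t := cs.simple i) (w := w⁻¹) (x := x)
    rw [inv_inv] at this
    rwa [this, R.mem_hyperplane_simple, ← R.inner_rep_left]
  · rintro h ⟨_, ⟨_, ⟨w, i, rfl⟩, rfl⟩, hx⟩
    have := R.mem_hyperplane_conj (t := cs.simple i) (w := w⁻¹) (x := x)
    rw [inv_inv] at this
    rw [this, R.mem_hyperplane_simple, ← R.inner_rep_left] at hx
    exact h w i hx

/-- The image under `w` of the fundamental chamber. -/
def chamber (w : W) : Set V := {x | ∀ i, 0 < inner ℝ (R.rep w (R.root i)) x}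

theorem convex_chamber (w : W) : Convex ℝ (R.chamber w) := by
  intro x hx y hy a b ha hb hab i
  rw [inner_add_right, inner_smul_right, inner_smul_right]
  rcases ha.eq_or_lt with h | h
  · have hb1 : b = 1 := by linarith
    rw [← h, hb1]
    simpa using hy i
  · exact add_pos_of_pos_of_nonneg (mul_pos h (hx i)) (mul_nonneg hb (hy i).le)

variable [FiniteDimensional ℝ V]

theorem rep_facePoint_mem_chamber (w : W) : R.rep w (R.facePoint ∅) ∈ R.chamber w := by
  intro i
  rw [LinearIsometryEquiv.inner_map_map, real_inner_comm, R.inner_facePoint_root]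
  simp

theorem closure_chamber (w : W) :
    closure (R.chamber w) = {x | ∀ i, 0 ≤ inner ℝ (R.rep w (R.root i)) x} := by
  apply subset_antisymm
  · refine closure_minimal (fun x hx i => (hx i).le) ?_
    simp only [Set.ofPred_forall]
    exact isClosed_iInter fun i => isClosed_le continuous_const (by fun_prop)
  · intro x hx
    have hlim : Filter.Tendsto (fun ε : ℝ => x + ε • R.rep w (R.facePoint ∅))
        (nhdsWithin 0 (Set.Ioi 0)) (nhds x) := by
      have : Filter.Tendsto (fun ε : ℝ => x + ε • R.rep w (R.facePoint ∅)) (nhds 0)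
          (nhds (x + (0 : ℝ) • R.rep w (R.facePoint ∅))) := Continuous.tendsto (by fun_prop) 0
      rw [zero_smul, add_zero] at this
      exact this.mono_left nhdsWithin_le_nhds
    refine mem_closure_of_tendsto hlim ?_
    filter_upwards [self_mem_nhdsWithin] with ε hε i
    rw [inner_add_right, inner_smul_right]
    exact add_pos_of_nonneg_of_pos (hx i) (mul_pos hε (R.rep_facePoint_mem_chamber w i))

variable [Finite B]

theorem inner_ne_zero_of_isRoot {y β : V} (hy : ∀ i, 0 < inner ℝ y (R.root i))
    (hβ : R.IsRoot β) : inner ℝ y β ≠ 0 := by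
  cases nonempty_fintype B
  have key : ∀ β, R.IsRoot β → R.IsNonneg β → inner ℝ y β ≠ 0 := by
    intro β hβ hn h0
    rw [R.inner_eq_zero_iff_of_isNonneg (fun i _ => (hy i).le) hβ.mem_span hn] at h0
    apply hβ.ne_zero
    rw [R.eq_sum_coweight hβ.mem_span]
    refine Finset.sum_eq_zero fun i _ => ?_
    by_cases hi : inner ℝ (R.coweight i) β = 0
    · rw [hi, zero_smul]
    · exact absurd (h0 i hi) (hy i).ne'
  rcases hβ.isNonneg_or with h | h
  · exact key β hβ h
  · have := key _ hβ.neg h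
    rwa [inner_neg_right, neg_ne_zero] at this

theorem chamber_subset_compl (w : W) : R.chamber w ⊆ (⋃₀ R.arrangement)ᶜ := by
  intro x hx
  rw [R.mem_compl_iff]
  intro v i
  have h := R.inner_ne_zero_of_isRoot (y := R.rep w⁻¹ x) (β := R.rep (w⁻¹ * v) (R.root i))
    (fun j => by
      rw [← R.inner_rep_right, real_inner_comm]
      exact hx j) ⟨_, i, rfl⟩
  rwa [R.rep_mul_apply, LinearIsometryEquiv.inner_map_map, real_inner_comm] at h

/-- A chamber is convex, and leaving it inside a connected set crosses a hyperplane by the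
intermediate value theorem. -/
theorem connectedComponentIn_eq_chamber {w : W} {x : V} (hx : x ∈ R.chamber w) :
    connectedComponentIn (⋃₀ R.arrangement)ᶜ x = R.chamber w := by
  apply subset_antisymm
  · intro y hy i
    by_contra! hneg
    have hc : IsPreconnected (connectedComponentIn (⋃₀ R.arrangement)ᶜ x) :=
      isPreconnected_connectedComponentIn
    have hmem := mem_connectedComponentIn (R.chamber_subset_compl w hx)
    obtain ⟨z, hz, hz0⟩ := hc.intermediate_value hy hmem
      (f := fun v => inner ℝ (R.rep w (R.root i)) v) (by fun_prop) ⟨hneg, (hx i).le⟩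
    exact R.mem_compl_iff.mp (connectedComponentIn_subset _ _ hz) w i hz0
  · exact (R.convex_chamber w).isPreconnected.subset_connectedComponentIn hx
      (R.chamber_subset_compl w)

omit [Finite B] in
theorem exists_mem_chamber [Finite W] {x : V} (hx : x ∈ (⋃₀ R.arrangement)ᶜ) :
    ∃ w, x ∈ R.chamber w := by
  -- The translate of the base point with the largest inner product with `x` lies in the chamber of
  -- `x`: otherwise reflecting in a wall would increase it.
  obtain ⟨w, -, hmax⟩ := Set.exists_max_image (Set.univ : Set W)
    (fun w => inner ℝ (R.rep w (R.facePoint ∅)) x) (Set.toFinite _) ⟨1, trivial⟩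
  refine ⟨w, fun i => ?_⟩
  have h := hmax (w * cs.simple i) trivial
  rw [R.rep_mul_apply, R.rep_simple_apply, map_sub, map_smul, inner_sub_left, inner_smul_left,
    real_inner_comm (R.facePoint ∅) (R.root i), R.inner_facePoint_root] at h
  simp only [Set.mem_empty_iff_false, if_false, mul_one, conj_trivial] at h
  refine lt_of_le_of_ne ?_ (R.mem_compl_iff.mp hx w i).symm
  linarith

theorem chambers_eq [Finite W] : HypArr.chambers R.arrangement = Set.range R.chamber := by
  ext C
  constructor
  · rintro ⟨x, hx, rfl⟩
    obtain ⟨w, hw⟩ := R.exists_mem_chamber hx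
    exact ⟨w, (R.connectedComponentIn_eq_chamber hw).symm⟩
  · rintro ⟨w, rfl⟩
    have hw := R.rep_facePoint_mem_chamber w
    exact ⟨_, R.chamber_subset_compl w hw, (R.connectedComponentIn_eq_chamber hw).symm⟩

theorem chamber_injective : Function.Injective R.chamber := by
  intro w v h
  have h1 := R.rep_facePoint_mem_chamber w
  rw [h] at h1
  have h2 : w⁻¹ * v = 1 := by
    refine R.eq_one_of_isNonneg fun i => ?_
    have hroot : R.IsRoot (R.rep (w⁻¹ * v) (R.root i)) := ⟨_, i, rfl⟩
    refine hroot.isNonneg_or.resolve_right fun hneg => ?_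
    have h3 := R.inner_nonneg_of_isNonneg (fun i _ => R.inner_facePoint_root_nonneg ∅ i)
      hroot.neg.mem_span hneg
    have h4 := h1 i
    rw [R.inner_rep_right, ← R.rep_mul_apply, real_inner_comm] at h4
    rw [inner_neg_right] at h3
    linarith
  exact inv_mul_eq_one.mp h2

/-! ### The minimal edge containing the intersection of a closed chamber and a hyperplane -/

omit [FiniteDimensional ℝ V] [Finite B] in
theorem image_simpleFlat_mem_edges {K : Set B} (hK : K.Nonempty) (w : W) :
    R.rep w '' R.simpleFlat K ∈ HypArr.edges R.arrangement := by
  refine ⟨⟨_, 0, fun k _ => by simp, rfl⟩,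
    (fun k => R.hyperplane (w * cs.simple k * w⁻¹)) '' K, ?_, hK.image _, ?_⟩
  · rintro _ ⟨k, -, rfl⟩
    exact ⟨_, ⟨w, k, rfl⟩, rfl⟩
  · have hmem : ∀ (k : B) (x : V), x ∈ R.hyperplane (w * cs.simple k * w⁻¹) ↔
        inner ℝ (R.root k) (R.rep w⁻¹ x) = 0 := by
      intro k x
      have := R.mem_hyperplane_conj (t := cs.simple k) (w := w⁻¹) (x := x)
      rw [inv_inv] at this
      rw [this, R.mem_hyperplane_simple]
    ext x
    simp only [Set.sInter_image, Set.mem_iInter, hmem]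
    constructor
    · rintro ⟨y, hy, rfl⟩ k hk
      rw [R.rep_inv_rep]
      exact hy k hk
    · exact fun h => ⟨_, h, R.rep_rep_inv w x⟩

omit [FiniteDimensional ℝ V] [Finite B] in
theorem sub_mem_of_mem_edges {F : Set V} (hF : F ∈ HypArr.edges R.arrangement) {x y : V}
    (hx : x ∈ F) (hy : y ∈ F) : x - y ∈ F := by
  obtain ⟨-, G, hG, -, rfl⟩ := hF
  intro H hH
  obtain ⟨t, -, rfl⟩ := hG hH
  have h1 : R.rep t x = x := hx (R.hyperplane t) hH
  have h2 : R.rep t y = y := hy (R.hyperplane t) hH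
  change R.rep t (x - y) = x - y
  rw [map_sub, h1, h2]

theorem isLeast_edge {r : W} (hr : cs.IsReflection r) (w : W) :
    IsLeast {F ∈ HypArr.edges R.arrangement | closure (R.chamber w) ∩ R.hyperplane r ⊆ F}
      (R.rep w '' R.simpleFlat (R.rootSupport (w⁻¹ * r * w))) := by
  cases nonempty_fintype B
  set t := w⁻¹ * r * w with ht_def
  have ht : cs.IsReflection t := by simpa using hr.conj w⁻¹
  have hH : ∀ y, R.rep w y ∈ R.hyperplane r ↔ inner ℝ y (R.posRoot t) = 0 := fun y => by
    rw [← R.mem_hyperplane_conj, ← ht_def, R.mem_hyperplane_iff ht, real_inner_comm]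
  have hface : ∀ y, (∀ i, 0 ≤ inner ℝ y (R.root i)) →
      (inner ℝ y (R.posRoot t) = 0 ↔ y ∈ R.simpleFlat (R.rootSupport t)) := fun y hy => by
    rw [R.inner_eq_zero_iff_of_isNonneg (fun i _ => hy i) (R.isRoot_posRoot ht).mem_span
      (R.isNonneg_posRoot ht)]
    exact forall_congr' fun k => by rw [real_inner_comm y]; rfl
  refine ⟨⟨R.image_simpleFlat_mem_edges (R.rootSupport_nonempty ht) w, ?_⟩, ?_⟩
  · rintro x ⟨hx, hxr⟩
    refine ⟨R.rep w⁻¹ x, ?_, R.rep_rep_inv w x⟩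
    rw [R.closure_chamber] at hx
    rw [← hface]
    · rw [← hH, R.rep_rep_inv]
      exact hxr
    · intro i
      rw [← R.inner_rep_right, real_inner_comm]
      exact hx i
  · rintro F ⟨hF, hsub⟩ _ ⟨y, hy, rfl⟩
    have hmem : ∀ z ∈ R.simpleFlat (R.rootSupport t), (∀ i, 0 ≤ inner ℝ z (R.root i)) →
        R.rep w z ∈ F := by
      intro z hz hdom
      refine hsub ⟨?_, (hH z).mpr ((hface z hdom).mpr hz)⟩
      rw [R.closure_chamber]
      intro i
      rw [LinearIsometryEquiv.inner_map_map, real_inner_comm]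
      exact hdom i
    set K := R.rootSupport t
    set N : ℝ := ∑ i, |inner ℝ y (R.root i)|
    have hN : 0 ≤ N := Finset.sum_nonneg fun i _ => abs_nonneg _
    have hz : ∀ k ∈ K, inner ℝ (R.root k) (R.facePoint K) = 0 := fun k hk => by
      rw [real_inner_comm]; exact R.inner_facePoint_root_eq_zero_iff.mpr hk
    have h1 : R.rep w (N • R.facePoint K) ∈ F := by
      refine hmem _ (fun k hk => ?_) fun i => ?_
      · rw [inner_smul_right, hz k hk, mul_zero]
      · rw [inner_smul_left]
        exact mul_nonneg hN (R.inner_facePoint_root_nonneg K i)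
    -- Any `y` of the flat is the difference of `y + N p` and `N p`, for `p` inside the face. The
    -- constant `N` is large enough to put both in the closed chamber, and edges are closed under
    -- subtraction.
    have h2 : R.rep w (y + N • R.facePoint K) ∈ F := by
      refine hmem _ (fun k hk => ?_) fun i => ?_
      · rw [inner_add_right, inner_smul_right, hz k hk, hy k hk, mul_zero, add_zero]
      · rw [inner_add_left, inner_smul_left, R.inner_facePoint_root, conj_trivial]
        split_ifs with hi
        · rw [real_inner_comm, hy i hi, mul_zero, add_zero]
        · have h3 := Finset.single_le_sum (f := fun i => |inner ℝ y (R.root i)|)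
            (fun i _ => abs_nonneg _) (Finset.mem_univ i)
          have h4 := neg_abs_le (inner ℝ y (R.root i))
          change _ ≤ N at h3
          rw [mul_one]
          linarith
    have h3 := R.sub_mem_of_mem_edges hF h2 h1
    rwa [← map_sub, add_sub_cancel_right] at h3

theorem multiplicity_eq [Finite W] (E : Set V) {r : W} (hr : cs.IsReflection r) :
    HypArr.multiplicity R.arrangement E (R.hyperplane r) =
      ({w | R.rep w '' R.simpleFlat (R.rootSupport (w⁻¹ * r * w)) = E}.ncard : ℚ) / 2 := by
  unfold HypArr.multiplicity
  rw [← Set.ncard_image_of_injective _ R.chamber_injective]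
  congr 3
  ext C
  rw [R.chambers_eq]
  constructor
  · rintro ⟨⟨w, rfl⟩, h⟩
    exact ⟨w, (R.isLeast_edge hr w).unique h, rfl⟩
  · rintro ⟨w, rfl, rfl⟩
    exact ⟨⟨w, rfl⟩, R.isLeast_edge hr w⟩

omit [FiniteDimensional ℝ V] [Finite B] in
theorem edge_conjSet_reflectionsIn (K : Set B) (w : W) :
    R.edge (conjSet (cs.reflectionsIn (cs.simple '' K)) w) = R.rep w⁻¹ '' R.simpleFlat K := by
  ext x
  have h1 : x ∈ R.edge (conjSet (cs.reflectionsIn (cs.simple '' K)) w) ↔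
      ∀ u ∈ cs.reflectionsIn (cs.simple '' K), R.rep w x ∈ R.hyperplane u := by
    simp only [edge, conjSet, Set.mem_iInter, Set.forall_mem_image, R.mem_hyperplane_conj]
  rw [h1]
  constructor
  · intro h
    refine ⟨R.rep w x, fun k hk => ?_, R.rep_inv_rep w x⟩
    rw [← R.mem_hyperplane_simple]
    exact h _ ⟨cs.isReflection_simple k, simple_mem_parabolic hk⟩
  · rintro ⟨y, hy, rfl⟩ u hu
    rw [R.rep_rep_inv]
    exact R.rep_eq_self_of_mem_parabolic hu.2 hy

end Realization
end CoxeterSystem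

namespace CoxeterSystem

namespace Realization

variable {B W V : Type*} [Group W] {M : CoxeterMatrix B} {cs : CoxeterSystem M W}
  [NormedAddCommGroup V] [InnerProductSpace ℝ V] (R : cs.Realization V)

/-! ### Conjugacy of simple reflections -/

theorem inner_root_le_neg_half {i j : B} (hij : i ≠ j) (h : inner ℝ (R.root i) (R.root j) ≠ 0) :
    inner ℝ (R.root i) (R.root j) ≤ -(1 / 2) := by
  have h2 := R.two_le_coxeterMatrix hij
  have h3 : 3 ≤ M i j := by
    by_contra hlt
    apply h
    rw [R.inner_root, show M i j = 2 by omega]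
    simp
  rw [R.inner_root, neg_le_neg_iff, ← Real.cos_pi_div_three]
  have h3' : (3 : ℝ) ≤ M i j := by exact_mod_cast h3
  apply Real.cos_le_cos_of_nonneg_of_le_pi (by positivity)
  · linarith [Real.pi_pos]
  · exact div_le_div_of_nonneg_left Real.pi_pos.le (by norm_num) h3'

/-- The Coxeter graph. -/
def graph : SimpleGraph B where
  Adj i j := i ≠ j ∧ inner ℝ (R.root i) (R.root j) ≠ 0
  symm := ⟨fun i j h => ⟨h.1.symm, by rw [real_inner_comm]; exact h.2⟩⟩
  loopless := ⟨fun i h => h.1 rfl⟩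

/-- On a cycle each vertex has two neighbours with inner products at most `-1/2`, so all row sums of
the Gram matrix are at most 0, and the roots of the cycle sum to zero. -/
theorem isAcyclic_graph : R.graph.IsAcyclic := by
  classical
  intro v c hc
  set T := c.support.toFinset with hT
  have hrow : ∀ i ∈ T, ∑ j ∈ T, inner ℝ (R.root i) (R.root j) ≤ 0 := by
    intro i hi
    have hi' : i ∈ c.support := List.mem_toFinset.mp hi
    obtain ⟨a, b, hab, hN⟩ := Set.ncard_eq_two.mp (hc.ncard_neighborSet_toSubgraph_eq_two hi')
    have hnb : ∀ a ∈ c.toSubgraph.neighborSet i, a ∈ T.erase i ∧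
        inner ℝ (R.root i) (R.root a) ≤ -(1 / 2) := by
      intro a ha
      have hadj : R.graph.Adj i a := c.toSubgraph.adj_sub ha
      refine ⟨Finset.mem_erase.mpr ⟨hadj.1.symm, List.mem_toFinset.mpr ?_⟩,
        R.inner_root_le_neg_half hadj.1 hadj.2⟩
      exact c.mem_verts_toSubgraph.mp (c.toSubgraph.edge_vert (c.toSubgraph.adj_symm ha))
    obtain ⟨ha, ha'⟩ := hnb a (by rw [hN]; simp)
    obtain ⟨hb, hb'⟩ := hnb b (by rw [hN]; simp)
    rw [← Finset.add_sum_erase T _ hi, R.inner_root_self,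
      ← Finset.add_sum_erase _ _ ha, ← Finset.add_sum_erase ((T.erase i).erase a) _
      (Finset.mem_erase.mpr ⟨hab.symm, hb⟩)]
    have : ∑ j ∈ ((T.erase i).erase a).erase b, inner ℝ (R.root i) (R.root j) ≤ 0 := by
      refine Finset.sum_nonpos fun j hj => R.inner_root_nonpos ?_
      have := Finset.mem_of_mem_erase (Finset.mem_of_mem_erase hj)
      exact (Finset.ne_of_mem_erase this).symm
    linarith
  have hx : ∑ i ∈ T, R.root i = 0 := by
    refine (inner_self_eq_zero (𝕜 := ℝ)).mp (le_antisymm ?_ real_inner_self_nonneg)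
    rw [sum_inner]
    simp only [inner_sum]
    exact Finset.sum_nonpos hrow
  have := linearIndependent_iff'.mp R.linearIndependent_root T (fun _ => 1) (by simpa using hx) v
    (List.mem_toFinset.mpr c.start_mem_support)
  exact one_ne_zero this

/-- The graph joining the simple reflections whose product has odd order. -/
def _root_.CoxeterMatrix.oddGraph (M : CoxeterMatrix B) : SimpleGraph B where
  Adj i j := i ≠ j ∧ Odd (M i j)
  symm := ⟨fun i j h => ⟨h.1.symm, by rw [M.symmetric]; exact h.2⟩⟩
  loopless := ⟨fun i h => h.1 rfl⟩

theorem oddGraph_le_graph : M.oddGraph ≤ R.graph := by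
  rintro i j ⟨hij, hodd⟩
  refine ⟨hij, fun h0 => ?_⟩
  have h2 := R.two_le_coxeterMatrix hij
  have h3 : 3 ≤ M i j := by
    by_contra hlt
    rw [show M i j = 2 by omega] at hodd
    exact absurd hodd (by decide)
  have h3' : (3 : ℝ) ≤ M i j := by exact_mod_cast h3
  rw [R.inner_root, neg_eq_zero] at h0
  refine (Real.cos_pos_of_mem_Ioo ⟨?_, ?_⟩).ne' h0
  · have : 0 < Real.pi / M i j := by positivity
    linarith [Real.pi_pos]
  · exact div_lt_div_of_pos_left Real.pi_pos (by norm_num) (by linarith)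

/-- The assignment `-1` on the component of `i` and `1` elsewhere respects the relations, even
exponents imposing nothing; the resulting character separates the components. -/
theorem reachable_oddGraph_of_isConj (cs : CoxeterSystem M W) {i j : B}
    (h : IsConj (cs.simple i) (cs.simple j)) : M.oddGraph.Reachable i j := by
  classical
  let f : B → ℤˣ := fun k => if M.oddGraph.Reachable i k then -1 else 1
  have hf : M.IsLiftable f := by
    intro k l
    rcases Nat.even_or_odd (M k l) with ⟨n, hn⟩ | hodd
    · rw [hn, pow_add, Int.units_mul_self]
    · have hkl : f k = f l := by
        rcases eq_or_ne k l with rfl | hne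
        · rfl
        · have hadj : M.oddGraph.Adj k l := ⟨hne, hodd⟩
          refine if_congr ⟨fun h => h.trans hadj.reachable, fun h => h.trans hadj.symm.reachable⟩
            rfl rfl
      rw [hkl, Int.units_mul_self, one_pow]
  have h1 := (cs.lift ⟨f, hf⟩).map_isConj h
  rw [isConj_iff_eq, cs.lift_apply_simple, cs.lift_apply_simple] at h1
  by_contra hcon
  simp only [f, hcon, if_false, SimpleGraph.Reachable.refl, if_true] at h1
  exact absurd h1 (by decide)

theorem exists_conj_eq_of_odd (cs : CoxeterSystem M W) {K : Set B} {i j : B} (hi : i ∈ K)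
    (hj : j ∈ K) (h : Odd (M i j)) :
    ∃ u ∈ parabolic (cs.simple '' K), u⁻¹ * cs.simple i * u = cs.simple j := by
  obtain ⟨n, hn⟩ := h
  refine ⟨(cs.simple j * cs.simple i) ^ n,
    pow_mem (mul_mem (simple_mem_parabolic hj) (simple_mem_parabolic hi)) n, ?_⟩
  have h1 : (cs.simple j * cs.simple i)⁻¹ = cs.simple i * cs.simple j := by simp
  have h2 : cs.simple i * (cs.simple j * cs.simple i) ^ n =
      (cs.simple i * cs.simple j) ^ n * cs.simple i := by
    clear hn
    induction n with
    | zero => simp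
    | succ n ih => rw [pow_succ, ← mul_assoc, ih, pow_succ]; simp only [mul_assoc]
  have h3 := cs.simple_mul_simple_pow i j
  rw [← inv_pow, h1, mul_assoc, h2, ← mul_assoc, ← pow_add]
  rw [hn, pow_succ, two_mul, ← mul_assoc] at h3
  have h4 := eq_inv_of_mul_eq_one_left h3
  rw [cs.inv_simple] at h4
  exact h4

theorem exists_conj_eq_of_walk (cs : CoxeterSystem M W) {K : Set B} {i j : B}
    (p : M.oddGraph.Walk i j) (hp : ∀ k ∈ p.support, k ∈ K) :
    ∃ u ∈ parabolic (cs.simple '' K), u⁻¹ * cs.simple i * u = cs.simple j := by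
  induction p with
  | nil => exact ⟨1, one_mem _, by simp⟩
  | @cons i k j h p ih =>
    obtain ⟨u, hu, hu'⟩ := ih fun l hl => hp l (by simp [hl])
    obtain ⟨v, hv, hv'⟩ := exists_conj_eq_of_odd cs (hp i (by simp))
      (hp k (by simp)) h.2
    refine ⟨v * u, mul_mem hv hu, ?_⟩
    rw [← hu', ← hv', mul_inv_rev]
    simp only [mul_assoc]

variable [FiniteDimensional ℝ V] [Finite B]

theorem induce_graph_reachable {J : Set B} (hJ : IsIrreducible (cs.simple '' J)) (i j : J) :
    (R.graph.induce J).Reachable i j := by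
  by_contra hcon
  obtain ⟨-, hirr⟩ := R.isIrreducible_image_iff.mp hJ
  obtain ⟨k, ⟨hkJ, hk⟩, l, ⟨hlJ, hl⟩, hne⟩ := hirr
    {k | ∃ h : k ∈ J, (R.graph.induce J).Reachable i ⟨k, h⟩} (fun k hk => hk.1)
    ⟨i, i.2, .refl _⟩ ⟨j, j.2, fun h => hcon h.2⟩
  apply hl
  refine ⟨hlJ, hk.trans (SimpleGraph.Adj.reachable ?_)⟩
  refine ⟨?_, hne⟩
  rintro rfl
  exact hl ⟨hkJ, hk⟩

include R in
-- An odd path from `i` to `j` is a path in the Coxeter graph. That graph is a forest, so the path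
-- coincides with the one inside the connected set `J`, and all the conjugations take place in
-- `W_J`.
theorem exists_conj_simple_eq_of_isConj {J : Set B} (hJ : IsIrreducible (cs.simple '' J)) {i j : B}
    (hi : i ∈ J) (hj : j ∈ J) (h : IsConj (cs.simple i) (cs.simple j)) :
    ∃ u ∈ parabolic (cs.simple '' J), u⁻¹ * cs.simple i * u = cs.simple j := by
  classical
  obtain ⟨p, hp⟩ := (reachable_oddGraph_of_isConj cs h).exists_isPath
  obtain ⟨q, hq⟩ := (R.induce_graph_reachable hJ ⟨i, hi⟩ ⟨j, hj⟩).exists_isPath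
  refine exists_conj_eq_of_walk cs p fun k hk => ?_
  have hp' : (p.mapLe R.oddGraph_le_graph).IsPath := hp.mapLe _
  have hq' : (q.map (SimpleGraph.Embedding.induce J).toHom).IsPath :=
    hq.map Subtype.val_injective
  have heq := congrArg (fun P : R.graph.Path i j => P.1.support)
    ((R.isAcyclic_graph.subsingleton_path i j).elim ⟨_, hp'⟩ ⟨_, hq'⟩)
  have hsupp : p.support = q.support.map Subtype.val :=
    (SimpleGraph.Walk.support_mapLe_eq_support R.oddGraph_le_graph p).symm.trans
      (heq.trans (SimpleGraph.Walk.support_map _ q))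
  rw [hsupp, List.mem_map] at hk
  obtain ⟨x, -, rfl⟩ := hk
  exact x.2

/-- Reflections with the same irreducible support that are conjugate in the group are conjugate in
the parabolic subgroup. -/
theorem exists_conj_eq_of_isConj {J : Set B} (hJ : IsIrreducible (cs.simple '' J)) {t t' : W}
    (ht : cs.IsReflection t) (ht' : cs.IsReflection t') (hs : R.rootSupport t = J)
    (hs' : R.rootSupport t' = J) (h : IsConj t t') :
    ∃ u ∈ parabolic (cs.simple '' J), u⁻¹ * t * u = t' := by
  obtain ⟨s, v, hv⟩ := R.exists_isReducedConj ht
  obtain ⟨s', v', hv'⟩ := R.exists_isReducedConj ht'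
  obtain ⟨⟨i, hi, rfl⟩, hvJ⟩ := R.mem_parabolic_of_isReducedConj hv
    ((R.support_eq_image_rootSupport ht).trans (by rw [hs]))
  obtain ⟨⟨j, hj, rfl⟩, hvJ'⟩ := R.mem_parabolic_of_isReducedConj hv'
    ((R.support_eq_image_rootSupport ht').trans (by rw [hs']))
  have h1 : IsConj (cs.simple i) t := isConj_iff.mpr ⟨v⁻¹, by rw [hv.2.1, inv_inv]⟩
  have h2 : IsConj (cs.simple j) t' := isConj_iff.mpr ⟨v'⁻¹, by rw [hv'.2.1, inv_inv]⟩
  obtain ⟨u, hu, hu'⟩ := R.exists_conj_simple_eq_of_isConj hJ hi hj ((h1.trans h).trans h2.symm)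
  refine ⟨v⁻¹ * u * v', mul_mem (mul_mem (inv_mem hvJ) hu) hvJ', ?_⟩
  rw [hv'.2.1, ← hu', hv.2.1]
  group

end Realization
end CoxeterSystem

namespace CoxeterSystem

namespace Realization

variable {B W V : Type*} [Group W] {M : CoxeterMatrix B} {cs : CoxeterSystem M W}
  [NormedAddCommGroup V] [InnerProductSpace ℝ V] (R : cs.Realization V)
  [FiniteDimensional ℝ V]

/-! ### Conjugates with full support and bounded cells -/

/-- The elements of `W_J` conjugating `r` to a reflection whose root involves all simple roots
in `J`. -/
def fullConjugators (J : Set B) (r : W) : Set W :=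
  {u | u ∈ parabolic (cs.simple '' J) ∧ R.rootSupport (u⁻¹ * r * u) = J}

variable [Finite W]

variable (cs) in
/-- The reflections in `W_J`. -/
noncomputable def reflectionFinset (J : Set B) : Finset W :=
  (Set.toFinite (cs.reflectionsIn (cs.simple '' J))).toFinset

omit [FiniteDimensional ℝ V] [NormedAddCommGroup V] [InnerProductSpace ℝ V] in
theorem mem_reflectionFinset {J : Set B} {t : W} : t ∈ reflectionFinset cs J ↔
    cs.IsReflection t ∧ t ∈ parabolic (cs.simple '' J) := by
  simp only [reflectionFinset, Set.Finite.mem_toFinset]; rfl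

theorem conj_mem_reflectionFinset {J : Set B} {t u : W} (ht : t ∈ reflectionFinset cs J)
    (hu : u ∈ parabolic (cs.simple '' J)) : u⁻¹ * t * u ∈ reflectionFinset cs J := by
  rw [mem_reflectionFinset] at ht ⊢
  exact ⟨by simpa using ht.1.conj u⁻¹, mul_mem (mul_mem (inv_mem hu) ht.2) hu⟩

open Classical in
/-- The reflections in `W_J` that are positive on the image of the fundamental chamber
under `u`. -/
noncomputable def positivitySet (J : Set B) (u : W) : Finset W :=
  (reflectionFinset cs J).filter fun t => 0 < inner ℝ (R.posRoot t) (R.rep u (R.facePoint ∅))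

variable [Finite B]

/-- The dictionary between cells and group elements: the functional of `t`, given its sign on the
chamber of `u` and pulled back by `u`, is the positive root of `u⁻¹ t u`. -/
theorem sgn_mul_inner_rep {J : Set B} {t u : W} (ht : t ∈ reflectionFinset cs J) (y : V) :
    LinearCells.sgn (R.positivitySet J u) t * inner ℝ (R.posRoot t) (R.rep u y) =
      inner ℝ (R.posRoot (u⁻¹ * t * u)) y := by
  classical
  have htr := (mem_reflectionFinset.mp ht).1
  have hroot := (R.isRoot_posRoot htr).rep u⁻¹
  have hmem : t ∈ R.positivitySet J u ↔ 0 < inner ℝ (R.facePoint ∅) (R.rep u⁻¹ (R.posRoot t)) := by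
    rw [positivitySet, Finset.mem_filter, and_iff_right ht, R.inner_rep_right, real_inner_comm]
  have hne : inner ℝ (R.facePoint ∅) (R.rep u⁻¹ (R.posRoot t)) ≠ 0 :=
    R.inner_ne_zero_of_isRoot (fun i => by rw [R.inner_facePoint_root]; simp) hroot
  have hdom : ∀ x : V, ∀ i, inner ℝ (R.coweight i) x ≠ 0 →
      0 ≤ inner ℝ (R.facePoint ∅) (R.root i) := fun _ i _ => R.inner_facePoint_root_nonneg ∅ i
  rw [R.inner_rep_right]
  rcases hroot.isNonneg_or with h | h
  · have h1 := R.posRoot_conj_of_isNonneg htr h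
    rw [inv_inv] at h1
    have h2 := R.inner_nonneg_of_isNonneg (hdom _) hroot.mem_span h
    rw [LinearCells.sgn, if_pos (hmem.mpr (h2.lt_of_ne' hne)), one_mul, h1]
  · have h1 := R.posRoot_conj_of_isNonneg_neg htr h
    rw [inv_inv] at h1
    have h2 := R.inner_nonneg_of_isNonneg (hdom _) hroot.neg.mem_span h
    rw [inner_neg_right] at h2
    rw [LinearCells.sgn, if_neg (fun h3 => by linarith [hmem.mp h3]), h1, inner_neg_left]
    ring

omit [Finite W] in
theorem posRoot_mem_span_of_mem_parabolic {J : Set B} {t : W} (ht : cs.IsReflection t)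
    (htJ : t ∈ parabolic (cs.simple '' J)) : R.posRoot t ∈ Submodule.span ℝ (R.root '' J) :=
  Submodule.span_mono (Set.image_mono ((R.mem_parabolic_iff_rootSupport_subset ht).mp htJ))
    (R.posRoot_mem_span_rootSupport ht)

omit [Finite W] in
theorem inner_posRoot_pos {J : Set B} {t : W} (ht : cs.IsReflection t)
    (htJ : t ∈ parabolic (cs.simple '' J)) {y : V} (hy : ∀ j ∈ J, 0 < inner ℝ y (R.root j)) :
    0 < inner ℝ (R.posRoot t) y := by
  have hsub := (R.mem_parabolic_iff_rootSupport_subset ht).mp htJ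
  have hz : ∀ i, inner ℝ (R.coweight i) (R.posRoot t) ≠ 0 → 0 ≤ inner ℝ y (R.root i) :=
    fun i hi => (hy i (hsub hi)).le
  rw [real_inner_comm]
  refine lt_of_le_of_ne (R.inner_nonneg_of_isNonneg hz (R.isRoot_posRoot ht).mem_span
    (R.isNonneg_posRoot ht)) fun h0 => ?_
  rw [eq_comm, R.inner_eq_zero_iff_of_isNonneg hz (R.isRoot_posRoot ht).mem_span
    (R.isNonneg_posRoot ht)] at h0
  obtain ⟨k, hk⟩ := R.rootSupport_nonempty ht
  exact (hy k (hsub hk)).ne' (h0 k hk)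

theorem isRealizable_positivitySet {J : Set B} {u : W} (hu : u ∈ parabolic (cs.simple '' J)) :
    LinearCells.IsRealizable (fun t => innerₗ V (R.posRoot t)) (⊤ : Submodule ℝ V)
      (reflectionFinset cs J) (LinearCells.sgn (R.positivitySet J u)) := by
  refine ⟨R.rep u (R.facePoint ∅), trivial, fun t ht => ?_⟩
  rw [innerₗ_apply_apply, R.sgn_mul_inner_rep ht]
  have h := mem_reflectionFinset.mp (conj_mem_reflectionFinset ht hu)
  exact R.inner_posRoot_pos h.1 h.2 fun j _ => by rw [R.inner_facePoint_root]; simp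

/-- Pulled back by `u`, the closed cell is the cone where all simple roots of `J` are nonnegative. A
coweight of `J` outside the support lies on the hyperplane and violates boundedness; full support
forces all simple roots of `J` to vanish. -/
theorem isBounded_positivitySet_iff {J : Set B} {u r : W} (hu : u ∈ parabolic (cs.simple '' J))
    (hr : r ∈ reflectionFinset cs J) :
    LinearCells.IsBounded (fun t => innerₗ V (R.posRoot t)) (⊤ : Submodule ℝ V)
      (reflectionFinset cs J) r (LinearCells.sgn (R.positivitySet J u)) ↔
      R.rootSupport (u⁻¹ * r * u) = J := by
  obtain ⟨hr', hr'J⟩ := mem_reflectionFinset.mp (conj_mem_reflectionFinset hr hu)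
  have hsub := (R.mem_parabolic_iff_rootSupport_subset hr').mp hr'J
  have hback : ∀ j ∈ J, u * cs.simple j * u⁻¹ ∈ reflectionFinset cs J := fun j hj => by
    have := conj_mem_reflectionFinset (u := u⁻¹) (mem_reflectionFinset.mpr
      ⟨cs.isReflection_simple j, simple_mem_parabolic hj⟩) (inv_mem hu)
    rwa [inv_inv] at this
  have hconj : ∀ j, u⁻¹ * (u * cs.simple j * u⁻¹) * u = cs.simple j := fun j => by group
  have hzero : ∀ t ∈ reflectionFinset cs J, ∀ y, inner ℝ (R.posRoot t) (R.rep u y) = 0 ↔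
      inner ℝ (R.posRoot (u⁻¹ * t * u)) y = 0 := fun t ht y => by
    rw [← R.sgn_mul_inner_rep ht, mul_eq_zero, or_iff_right (LinearCells.sgn_ne_zero _ _)]
  constructor
  · intro h
    refine hsub.antisymm fun j hj => ?_
    by_contra hjr
    have h1 := h (R.rep u (R.coweight j)) trivial (fun t ht => ?_) ?_ _ (hback j hj)
    · rw [innerₗ_apply_apply, hzero _ (hback j hj), hconj, R.posRoot_simple, real_inner_comm,
        R.inner_coweight_root, if_pos rfl] at h1
      exact one_ne_zero h1
    · rw [innerₗ_apply_apply, R.sgn_mul_inner_rep ht, real_inner_comm]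
      exact R.isNonneg_posRoot (mem_reflectionFinset.mp (conj_mem_reflectionFinset ht hu)).1 j
    · rw [innerₗ_apply_apply, hzero r hr, real_inner_comm]
      simpa [rootSupport] using hjr
  · intro h x _ hx hxr t ht
    obtain ⟨y, rfl⟩ : ∃ y, R.rep u y = x := ⟨_, R.rep_rep_inv u x⟩
    rw [innerₗ_apply_apply, hzero r hr, real_inner_comm] at hxr
    rw [R.inner_eq_zero_iff_of_isNonneg (fun j hj => ?_) (R.isRoot_posRoot hr').mem_span
      (R.isNonneg_posRoot hr')] at hxr
    · obtain ⟨ht', ht'J⟩ := mem_reflectionFinset.mp (conj_mem_reflectionFinset ht hu)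
      rw [innerₗ_apply_apply, hzero t ht]
      refine R.mem_span_iff_forall_mem_simpleFlat.mp
        (R.posRoot_mem_span_of_mem_parabolic ht' ht'J) y fun j hj => ?_
      rw [real_inner_comm]
      exact hxr j (h.ge hj)
    · have hjJ := hsub hj
      have h1 := hx _ (hback j hjJ)
      rwa [innerₗ_apply_apply, R.sgn_mul_inner_rep (hback j hjJ), hconj, R.posRoot_simple,
        real_inner_comm] at h1

theorem positivitySet_injOn (J : Set B) :
    Set.InjOn (R.positivitySet J) (parabolic (cs.simple '' J) : Set W) := by
  intro u hu v hv huv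
  have hg : v⁻¹ * u ∈ parabolic (cs.simple '' J) := mul_mem (inv_mem hv) hu
  have key : ∀ j ∈ J, R.IsNonneg (R.rep (v⁻¹ * u) (R.root j)) := by
    intro j hj
    have ht : u * cs.simple j * u⁻¹ ∈ reflectionFinset cs J := by
      have := conj_mem_reflectionFinset (u := u⁻¹) (mem_reflectionFinset.mpr
        ⟨cs.isReflection_simple j, simple_mem_parabolic hj⟩) (inv_mem hu)
      rwa [inv_inv] at this
    have h1 : R.rep (v⁻¹ * u) (R.root j) = R.posRoot (v⁻¹ * (u * cs.simple j * u⁻¹) * v) := by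
      refine ext_inner_right ℝ fun y => ?_
      rw [← R.sgn_mul_inner_rep (u := v) ht, ← huv, R.inner_rep_left, mul_inv_rev, inv_inv,
        R.rep_mul_apply]
      conv_rhs => rw [← R.rep_rep_inv u (R.rep v y)]
      rw [R.sgn_mul_inner_rep ht]
      rw [show u⁻¹ * (u * cs.simple j * u⁻¹) * u = cs.simple j by group, R.posRoot_simple]
    rw [h1]
    exact R.isNonneg_posRoot (mem_reflectionFinset.mp (conj_mem_reflectionFinset ht hv)).1
  by_contra hne
  obtain ⟨i, hi⟩ := cs.exists_rightDescent_of_ne_one (w := v⁻¹ * u)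
    fun h => hne (inv_mul_eq_one.mp h).symm
  exact R.isNonneg_rep_iff.mp (key i (R.mem_of_isRightDescent (R.rep_facePoint hg) hi)) hi

theorem exists_eq_positivitySet {J : Set B} {P : Finset W} (hP : P ⊆ reflectionFinset cs J)
    (h : LinearCells.IsRealizable (fun t => innerₗ V (R.posRoot t)) (⊤ : Submodule ℝ V)
      (reflectionFinset cs J) (LinearCells.sgn P)) :
    ∃ u ∈ parabolic (cs.simple '' J), P = R.positivitySet J u := by
  classical
  obtain ⟨x, -, hx⟩ := h
  obtain ⟨u, hu, hmax⟩ := Set.exists_max_image (parabolic (cs.simple '' J) : Set W)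
    (fun u => inner ℝ (R.rep u (R.facePoint ∅)) x) (Set.toFinite _) ⟨1, one_mem _⟩
  refine ⟨u, hu, ?_⟩
  have hpos : ∀ j ∈ J, 0 < inner ℝ (R.rep u⁻¹ x) (R.root j) := by
    intro j hj
    have h1 := hmax (u * cs.simple j) (mul_mem hu (simple_mem_parabolic hj))
    rw [R.rep_mul_apply, R.rep_simple_apply, map_sub, map_smul, inner_sub_left, inner_smul_left,
      real_inner_comm (R.facePoint ∅) (R.root j), R.inner_facePoint_root] at h1
    simp only [Set.mem_empty_iff_false, if_false, mul_one, conj_trivial] at h1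
    rw [← R.inner_rep_right, real_inner_comm]
    refine lt_of_le_of_ne (by linarith) fun h0 => ?_
    have ht : u * cs.simple j * u⁻¹ ∈ reflectionFinset cs J := by
      have := conj_mem_reflectionFinset (u := u⁻¹) (mem_reflectionFinset.mpr
        ⟨cs.isReflection_simple j, simple_mem_parabolic hj⟩) (inv_mem hu)
      rwa [inv_inv] at this
    have h2 := hx _ ht
    have h3 := R.sgn_mul_inner_rep (u := u) ht (R.rep u⁻¹ x)
    rw [show u⁻¹ * (u * cs.simple j * u⁻¹) * u = cs.simple j by group, R.posRoot_simple,
      ← R.inner_rep_left, ← h0, R.rep_rep_inv, mul_eq_zero,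
      or_iff_right (LinearCells.sgn_ne_zero _ _)] at h3
    rw [innerₗ_apply_apply, h3, mul_zero] at h2
    exact lt_irrefl _ h2
  have hcell : ∀ t ∈ reflectionFinset cs J,
      0 < LinearCells.sgn (R.positivitySet J u) t * inner ℝ (R.posRoot t) x := by
    intro t ht
    have h1 := R.sgn_mul_inner_rep (u := u) ht (R.rep u⁻¹ x)
    rw [R.rep_rep_inv] at h1
    rw [h1]
    have h2 := mem_reflectionFinset.mp (conj_mem_reflectionFinset ht hu)
    exact R.inner_posRoot_pos h2.1 h2.2 hpos
  ext t
  have hQ : R.positivitySet J u ⊆ reflectionFinset cs J := Finset.filter_subset _ _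
  by_cases ht : t ∈ reflectionFinset cs J
  · have h1 := hx t ht
    have h2 := hcell t ht
    rw [innerₗ_apply_apply] at h1
    unfold LinearCells.sgn at h1 h2
    split_ifs at h1 h2 with h3 h4 h4
    · exact iff_of_true h3 h4
    · linarith
    · linarith
    · exact iff_of_false h3 h4
  · exact iff_of_false (fun h => ht (hP h)) fun h => ht (hQ h)

/-- The realizable sign patterns of the reflections of `W_J` correspond bijectively to the elements
of `W_J`. -/
theorem ncard_fullConjugators {J : Set B} {r : W} (hr : r ∈ reflectionFinset cs J) :
    (R.fullConjugators J r).ncard = LinearCells.numBounded (fun t => innerₗ V (R.posRoot t))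
      (⊤ : Submodule ℝ V) (reflectionFinset cs J) r := by
  classical
  unfold LinearCells.numBounded
  rw [← Finset.card_filter, ← Set.ncard_coe_finset,
    ← ((R.positivitySet_injOn J).mono fun u hu => hu.1).ncard_image]
  congr 1
  ext P
  simp only [Finset.coe_filter, Finset.mem_powerset]
  constructor
  · rintro ⟨u, ⟨hu, hsupp⟩, rfl⟩
    exact ⟨Finset.filter_subset _ _, R.isRealizable_positivitySet hu,
      (R.isBounded_positivitySet_iff hu hr).mpr hsupp⟩
  · rintro ⟨hP, hreal, hbd⟩
    obtain ⟨u, hu, rfl⟩ := R.exists_eq_positivitySet hP hreal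
    exact ⟨u, ⟨hu, (R.isBounded_positivitySet_iff hu hr).mp hbd⟩, rfl⟩

theorem ncard_fullConjugators_eq {J : Set B} {r t : W} (hr : r ∈ reflectionFinset cs J)
    (ht : t ∈ reflectionFinset cs J) :
    (R.fullConjugators J r).ncard = (R.fullConjugators J t).ncard := by
  rw [R.ncard_fullConjugators hr, R.ncard_fullConjugators ht, LinearCells.numBounded_eq _ _ hr ht]

end Realization
end CoxeterSystem

theorem Set.ncard_eq_ncard_mul_of_fibers {α β : Type*} {A : Set α} {T : Set β} (hA : A.Finite)
    (hT : T.Finite) (f : α → β) (hf : ∀ a ∈ A, f a ∈ T) (n : ℕ)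
    (hn : ∀ b ∈ T, {a ∈ A | f a = b}.ncard = n) : A.ncard = T.ncard * n := by
  classical
  lift A to Finset α using hA
  lift T to Finset β using hT
  rw [Set.ncard_coe_finset, Set.ncard_coe_finset,
    Finset.card_eq_sum_card_fiberwise (f := f) (t := T) fun a ha => hf a ha,
    Finset.sum_const_nat]
  intro b hb
  rw [← hn b hb, ← Set.ncard_coe_finset]
  congr 1
  ext a
  simp

namespace CoxeterSystem

namespace Realization

variable {B W V : Type*} [Group W] {M : CoxeterMatrix B} {cs : CoxeterSystem M W}
  [NormedAddCommGroup V] [InnerProductSpace ℝ V] (R : cs.Realization V)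
  [FiniteDimensional ℝ V] [Finite B] [Finite W]

/-! ### Counting -/

/-- The centralizer of `t` in `W_J`. -/
def parabolicCentralizer (J : Set W) (t : W) : Set W := {c | c ∈ parabolic J ∧ c⁻¹ * t * c = t}

omit [Finite W] in
theorem ncard_parabolicCentralizer_conj (J : Set W) (s : W) {v : W} (hv : v ∈ parabolic J) :
    (parabolicCentralizer J (v⁻¹ * s * v)).ncard = (parabolicCentralizer J s).ncard := by
  rw [← Set.ncard_image_of_injective (parabolicCentralizer J s) (f := fun c => v⁻¹ * c * v)
    fun a b h => by simpa using h]
  congr 1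
  ext c
  constructor
  · rintro ⟨hc, h⟩
    refine ⟨v * c * v⁻¹, ⟨mul_mem (mul_mem hv hc) (inv_mem hv), ?_⟩, by group⟩
    calc (v * c * v⁻¹)⁻¹ * s * (v * c * v⁻¹) = v * (c⁻¹ * (v⁻¹ * s * v) * c) * v⁻¹ := by group
      _ = s := by rw [h]; group
  · rintro ⟨c, ⟨hc, h⟩, rfl⟩
    refine ⟨mul_mem (mul_mem (inv_mem hv) hc) hv, ?_⟩
    calc _ = v⁻¹ * (c⁻¹ * s * c) * v := by group
      _ = _ := by rw [h]

omit [Finite W] in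
theorem normalizerReps_eq (J K : Set B) : cs.normalizerReps (cs.simple '' J) (cs.simple '' K) =
    {w | w ∈ parabolic (cs.simple '' J) ∧ R.CarriesRoots K K w} := by
  ext w
  constructor
  · rintro ⟨h1, h2, -, h4⟩
    exact ⟨h1, carriesRoots_iff.mpr ⟨h2, h4⟩⟩
  · rintro ⟨h1, h2⟩
    exact ⟨h1, h2.mem_minCosetReps, h2.inv.mem_minCosetReps, (carriesRoots_iff.mp h2).2⟩

include R in
-- Centralizing `s_i` means sending its root to plus or minus itself; the stabilizer of the root and
-- its translate by `s_i` are the two halves.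
theorem ncard_parabolicCentralizer_simple {J : Set B} {i : B} (hi : i ∈ J) :
    (parabolicCentralizer (cs.simple '' J) (cs.simple i)).ncard =
      2 * (cs.normalizerReps (cs.simple '' J) {cs.simple i}).ncard := by
  have hX : cs.normalizerReps (cs.simple '' J) {cs.simple i} =
      {w | w ∈ parabolic (cs.simple '' J) ∧ R.rep w⁻¹ (R.root i) = R.root i} := by
    rw [← Set.image_singleton, R.normalizerReps_eq]
    simp only [CarriesRoots, Set.image_singleton, Set.singleton_eq_singleton_iff]
  set A := {w | w ∈ parabolic (cs.simple '' J) ∧ R.rep w⁻¹ (R.root i) = R.root i}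
  have himg : parabolicCentralizer (cs.simple '' J) (cs.simple i) =
      A ∪ (cs.simple i * ·) '' A := by
    ext w
    constructor
    · rintro ⟨hw, hc⟩
      have hroot : R.IsRoot (R.rep w⁻¹ (R.root i)) := ⟨w⁻¹, i, rfl⟩
      rcases hroot.isNonneg_or with h | h
      · exact .inl ⟨hw, (R.conj_simple_eq_iff h).mp hc⟩
      · refine .inr ⟨cs.simple i * w, ⟨mul_mem (simple_mem_parabolic hi) hw, ?_⟩, by simp⟩
        rw [← map_neg, ← R.rep_simple_root, ← R.rep_mul_apply] at h
        have h1 : (cs.simple i * w)⁻¹ = w⁻¹ * cs.simple i := by simp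
        rw [← R.conj_simple_eq_iff (by rwa [h1]), h1]
        calc w⁻¹ * cs.simple i * cs.simple i * (cs.simple i * w) = w⁻¹ * cs.simple i * w := by
              simp [mul_assoc]
          _ = cs.simple i := hc
    · have hA : ∀ w ∈ A, w⁻¹ * cs.simple i * w = cs.simple i := fun w hw =>
        (R.conj_simple_eq_iff (by rw [hw.2]; exact R.isNonneg_root i)).mpr hw.2
      rintro (hw | ⟨w, hw, rfl⟩)
      · exact ⟨hw.1, hA w hw⟩
      · refine ⟨mul_mem (simple_mem_parabolic hi) hw.1, ?_⟩
        have := hA w hw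
        simpa [mul_assoc] using this
  have hdisj : Disjoint A ((cs.simple i * ·) '' A) := by
    rw [Set.disjoint_left]
    rintro _ ⟨-, h1⟩ ⟨w, ⟨-, h2⟩, rfl⟩
    rw [mul_inv_rev, cs.inv_simple, R.rep_mul_apply, R.rep_simple_root, map_neg, h2] at h1
    exact (R.isRoot_root i).not_isNonneg_neg (R.isNonneg_root i)
      (by rw [h1]; exact R.isNonneg_root i)
  rw [himg, Set.ncard_union_eq hdisj, Set.ncard_image_of_injective _ (mul_right_injective _), hX]
  ring

theorem ncard_fullConjugators_eq_mul {J : Set B} (hJ : IsIrreducible (cs.simple '' J)) {t : W}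
    (ht : cs.IsReflection t) (hs : R.rootSupport t = J) :
    (R.fullConjugators J t).ncard = (cs.sameSupportConjugates t).ncard *
      (parabolicCentralizer (cs.simple '' J) t).ncard := by
  have hrefl : ∀ u, cs.IsReflection (u⁻¹ * t * u) := fun u => by simpa using ht.conj u⁻¹
  have hsupp : ∀ t', cs.IsReflection t' →
      (cs.support t' = cs.support t ↔ R.rootSupport t' = J) := fun t' ht' => by
    rw [R.support_eq_image_rootSupport ht, R.support_eq_image_rootSupport ht', hs,
      R.simple_injective.image_injective.eq_iff]
  refine Set.ncard_eq_ncard_mul_of_fibers (Set.toFinite _) (Set.toFinite _)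
    (fun u => u⁻¹ * t * u) ?_ _ ?_
  · exact fun u hu => ⟨(hsupp _ (hrefl u)).mpr hu.2, isConj_iff.mpr ⟨u⁻¹, by rw [inv_inv]⟩⟩
  · rintro t' ⟨ht's, hconj⟩
    have ht' : cs.IsReflection t' := by
      obtain ⟨c, rfl⟩ := isConj_iff.mp hconj
      exact ht.conj c
    obtain ⟨u, hu, rfl⟩ := R.exists_conj_eq_of_isConj hJ ht ht' hs ((hsupp t' ht').mp ht's) hconj
    rw [← Set.ncard_image_of_injective (parabolicCentralizer _ t) (mul_left_injective u)]
    congr 1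
    ext v
    constructor
    · rintro ⟨⟨hv, -⟩, h⟩
      refine ⟨v * u⁻¹, ⟨mul_mem hv (inv_mem hu), ?_⟩, by simp⟩
      calc (v * u⁻¹)⁻¹ * t * (v * u⁻¹) = u * (v⁻¹ * t * v) * u⁻¹ := by group
        _ = t := by rw [h]; group
    · rintro ⟨c, ⟨hc, h⟩, rfl⟩
      have h1 : (c * u)⁻¹ * t * (c * u) = u⁻¹ * t * u := by
        calc _ = u⁻¹ * (c⁻¹ * t * c) * u := by group
          _ = _ := by rw [h]
      exact ⟨⟨mul_mem hc hu, by rw [h1]; exact (hsupp _ ht').mp ht's⟩, h1⟩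

omit [FiniteDimensional ℝ V] [Finite B] [Finite W] in
theorem image_simpleFlat_of_conjSet {J K : Set B} {w : W}
    (h : conjSet (cs.simple '' J) w = cs.simple '' K) :
    R.rep w⁻¹ '' R.simpleFlat J = R.simpleFlat K := by
  have hK : ∀ x, x ∈ R.simpleFlat K ↔ R.rep w x ∈ R.simpleFlat J := by
    intro x
    have h1 : ∀ (L : Set B) x, x ∈ R.simpleFlat L ↔ ∀ s ∈ cs.simple '' L, x ∈ R.hyperplane s := by
      intro L x
      simp only [Set.forall_mem_image, R.mem_hyperplane_simple]
      rfl
    rw [h1, h1, ← h]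
    simp only [conjSet, Set.forall_mem_image, R.mem_hyperplane_conj]
  ext x
  rw [hK]
  constructor
  · rintro ⟨y, hy, rfl⟩
    rwa [R.rep_rep_inv]
  · exact fun hx => ⟨_, hx, R.rep_inv_rep w x⟩

omit [FiniteDimensional ℝ V] [Finite B] [Finite W] in
theorem image_simpleFlat_of_mem_parabolic {J : Set B} {u : W}
    (hu : u ∈ parabolic (cs.simple '' J)) : R.rep u '' R.simpleFlat J = R.simpleFlat J := by
  have h : ∀ x ∈ R.simpleFlat J, R.rep u x = x := fun x hx =>
    R.rep_eq_self_of_mem_parabolic hu hx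
  ext x
  constructor
  · rintro ⟨y, hy, rfl⟩
    rwa [h y hy]
  · exact fun hx => ⟨x, hx, h x hx⟩

theorem ncard_carriesRoots (J : Set B) : {d | ∃ K, R.CarriesRoots J K d}.ncard =
    (cs.coxeterClass (cs.simple '' J)).ncard *
      (cs.normalizerReps cs.simples (cs.simple '' J)).ncard := by
  refine Set.ncard_eq_ncard_mul_of_fibers (Set.toFinite _) (Set.toFinite _)
    (fun d => conjSet (cs.simple '' J) d) ?_ _ ?_
  · rintro d ⟨K, hd⟩
    refine ⟨?_, d, rfl⟩
    rw [(carriesRoots_iff.mp hd).2]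
    exact Set.image_subset_range _ _
  · rintro _ ⟨hsub, w, rfl⟩
    obtain ⟨K, hK⟩ := Set.subset_range_iff_exists_image_eq.mp hsub
    -- The conjugating element need not be minimal. Its `W_J` part fixes the flat of `J` pointwise,
    -- so the minimal part alone carries the flat, hence the simple roots.
    obtain ⟨u, hu, d, hd, rfl⟩ := exists_mul_mem_minCosetReps cs (cs.simple '' J) w
    have hdK : R.CarriesRoots J K d := by
      refine carriesRoots_of_image_simpleFlat hd ?_
      rw [← R.image_simpleFlat_of_conjSet hK.symm, mul_inv_rev]
      conv_lhs => rw [← R.image_simpleFlat_of_mem_parabolic (inv_mem hu)]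
      rw [Set.image_image]
      simp only [R.rep_mul_apply]
    have hX : cs.normalizerReps cs.simples (cs.simple '' J) = {w | R.CarriesRoots J J w} := by
      rw [simples, ← Set.image_univ, R.normalizerReps_eq]
      ext w
      exact and_iff_right (mem_parabolic_univ w)
    rw [hX, ← Set.ncard_image_of_injective {w | R.CarriesRoots J J w} (mul_left_injective d)]
    congr 1
    ext e
    constructor
    · rintro ⟨⟨L, hL⟩, he⟩
      have h1 : L = K := by
        have := (carriesRoots_iff.mp hL).2
        change conjSet (cs.simple '' J) e = _ at he
        rw [he, ← hK] at this
        exact (R.simple_injective.image_injective this).symm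
      rw [h1] at hL
      exact ⟨e * d⁻¹, hL.mul hdK.inv, by simp⟩
    · rintro ⟨e, he, rfl⟩
      have h1 := he.mul hdK
      exact ⟨⟨K, h1⟩, (carriesRoots_iff.mp h1).2.trans hK⟩

omit [Finite W] in
-- Under the unique factorization `y = u d`, the factor `u` fixes the flat, so the condition says
-- that `d` carries simple roots to simple roots; such a `d` only relabels supports, leaving the
-- condition on `u`.
theorem ncard_image_simpleFlat_eq {J : Set B} {r : W} (hr : cs.IsReflection r)
    (hrJ : r ∈ parabolic (cs.simple '' J)) :
    {y | R.rep y '' R.simpleFlat (R.rootSupport (y⁻¹ * r * y)) = R.simpleFlat J}.ncard =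
      (R.fullConjugators J r).ncard * {d | ∃ K, R.CarriesRoots J K d}.ncard := by
  rw [← Set.ncard_prod, ← Set.InjOn.ncard_image (f := fun p : W × W => p.1 * p.2)]
  · congr 1
    ext y
    constructor
    · intro hy
      obtain ⟨u, hu, d, hd, rfl⟩ := exists_mul_mem_minCosetReps cs (cs.simple '' J) y
      have h1 : R.rep d⁻¹ '' R.simpleFlat J =
          R.simpleFlat (R.rootSupport ((u * d)⁻¹ * r * (u * d))) := by
        conv_lhs => rw [← R.image_simpleFlat_of_mem_parabolic (inv_mem hu), ← hy]
        rw [Set.image_image, Set.image_image]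
        simp only [R.rep_mul_apply, R.rep_inv_rep, Set.image_id']
      have hd' := carriesRoots_of_image_simpleFlat hd h1
      refine ⟨(u, d), ⟨⟨hu, ?_⟩, _, hd'⟩, rfl⟩
      have ht : cs.IsReflection (u⁻¹ * r * u) := by simpa using hr.conj u⁻¹
      rw [← hd'.rootSupport_conj_eq_iff ht ((R.mem_parabolic_iff_rootSupport_subset ht).mp
        (mul_mem (mul_mem (inv_mem hu) hrJ) hu))]
      congr 1
      group
    · rintro ⟨⟨u, d⟩, ⟨⟨hu, hsupp⟩, K, hd⟩, rfl⟩
      have ht : cs.IsReflection (u⁻¹ * r * u) := by simpa using hr.conj u⁻¹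
      have h1 := (hd.rootSupport_conj_eq_iff ht hsupp.le).mpr hsupp
      change R.rep (u * d) '' R.simpleFlat (R.rootSupport ((u * d)⁻¹ * r * (u * d))) = _
      rw [show (u * d)⁻¹ * r * (u * d) = d⁻¹ * (u⁻¹ * r * u) * d by group, h1,
        ← hd.image_simpleFlat, Set.image_image]
      simp only [R.rep_mul_apply, R.rep_rep_inv]
      exact R.image_simpleFlat_of_mem_parabolic hu
  · rintro ⟨u, d⟩ ⟨hu, K, hd⟩ ⟨u', d'⟩ ⟨hu', K', hd'⟩ h
    obtain ⟨rfl, rfl⟩ := R.mul_minCosetReps_injective hu.1 hu'.1 hd.mem_minCosetReps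
      hd'.mem_minCosetReps h
    rfl

omit [Finite W] in
theorem mem_parabolic_of_image_simpleFlat_subset {J : Set B} {w r : W}
    (h : R.rep w⁻¹ '' R.simpleFlat J ⊆ R.hyperplane r) :
    w * r * w⁻¹ ∈ parabolic (cs.simple '' J) := by
  rw [R.mem_parabolic_iff]
  have h1 : R.facePoint J ∈ R.simpleFlat J := fun k hk => by
    rw [real_inner_comm]; exact R.inner_facePoint_root_eq_zero_iff.mpr hk
  have h2 := R.mem_hyperplane_conj (t := r) (w := w⁻¹) (x := R.facePoint J)
  rw [inv_inv] at h2
  exact h2.mpr (h ⟨_, h1, rfl⟩)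

theorem multiplicity_image_simpleFlat {J : Set B} {w r : W} (hr : cs.IsReflection r)
    (h : R.rep w⁻¹ '' R.simpleFlat J ⊆ R.hyperplane r) :
    HypArr.multiplicity R.arrangement (R.rep w⁻¹ '' R.simpleFlat J) (R.hyperplane r) =
      ((R.fullConjugators J (w * r * w⁻¹)).ncard * {d | ∃ K, R.CarriesRoots J K d}.ncard : ℚ)
        / 2 := by
  rw [R.multiplicity_eq _ hr, ← Nat.cast_mul, ← R.ncard_image_simpleFlat_eq (hr.conj w)
    (R.mem_parabolic_of_image_simpleFlat_subset h),
    ← Set.ncard_image_of_injective _ (mul_right_injective w)]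
  congr 3
  have key : ∀ x, R.rep x '' R.simpleFlat (R.rootSupport (x⁻¹ * r * x)) =
      R.rep w⁻¹ '' R.simpleFlat J ↔ R.rep (w * x) '' R.simpleFlat (R.rootSupport
        ((w * x)⁻¹ * (w * r * w⁻¹) * (w * x))) = R.simpleFlat J := by
    intro x
    rw [show (w * x)⁻¹ * (w * r * w⁻¹) * (w * x) = x⁻¹ * r * x by group]
    conv_rhs => rw [← (R.rep w⁻¹).injective.image_injective.eq_iff, Set.image_image]
    simp only [R.rep_mul_apply, R.rep_inv_rep]
  ext y
  constructor
  · rintro ⟨x, hx, rfl⟩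
    exact (key x).mp hx
  · intro hy
    refine ⟨w⁻¹ * y, (key _).mpr ?_, by simp⟩
    rwa [mul_inv_cancel_left]

/-! ### The weight of an edge -/

omit [Finite W] in
-- The component of `β` orthogonal to `α` lies on the common hyperplane, so it is orthogonal to
-- itself; the roots are therefore proportional.
theorem eq_of_hyperplane_eq {t t' : W} (ht : cs.IsReflection t) (ht' : cs.IsReflection t')
    (h : R.hyperplane t = R.hyperplane t') : t = t' := by
  apply R.eq_of_posRoot_eq ht ht'
  apply R.eq_posRoot ht' (R.isRoot_posRoot ht) (R.isNonneg_posRoot ht)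
  set α := R.posRoot t
  set β := R.posRoot t'
  have hα : inner ℝ α α = 1 := (R.isRoot_posRoot ht).inner_self
  have hβ : inner ℝ β β = 1 := (R.isRoot_posRoot ht').inner_self
  have h1 : inner ℝ α (β - inner ℝ α β • α) = 0 := by
    rw [inner_sub_right, inner_smul_right, hα]; ring
  have h2 : inner ℝ β (β - inner ℝ α β • α) = 0 := by
    rwa [← R.mem_hyperplane_iff ht', ← h, R.mem_hyperplane_iff ht]
  have h3 : β - inner ℝ α β • α = 0 := by
    rw [← @inner_self_eq_zero ℝ, inner_sub_left, inner_smul_left, h1, h2]; simp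
  have h4 : inner ℝ α β * inner ℝ α β = 1 := by
    rw [inner_sub_right, inner_smul_right, hβ, real_inner_comm α β] at h2
    linarith
  have h5 : α = inner ℝ α β • β := by
    rw [sub_eq_zero] at h3
    conv_rhs => rw [h3, smul_smul]
    rw [← h3, h4, one_smul]
  rw [h5, map_smul, R.rep_posRoot_self ht', smul_neg]

omit [Finite W] in
theorem weight_eq (J : Set B) (w : W) :
    HypArr.weight R.arrangement (R.rep w⁻¹ '' R.simpleFlat J) =
      ∏ᶠ u : cs.reflectionsIn (cs.simple '' J),
        R.var (w⁻¹ * u * w) (cs.isReflection_conj_of_mem u.2 w) := by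
  let e : cs.reflectionsIn (cs.simple '' J) → R.arrangement := fun u =>
    ⟨R.hyperplane (w⁻¹ * u * w), _, cs.isReflection_conj_of_mem u.2 w, rfl⟩
  have he : Function.Injective e := by
    intro u v huv
    have h := R.eq_of_hyperplane_eq (cs.isReflection_conj_of_mem u.2 w)
      (cs.isReflection_conj_of_mem v.2 w) (congrArg Subtype.val huv)
    exact Subtype.ext (by simpa using h)
  have hrange : ∀ H : R.arrangement, R.rep w⁻¹ '' R.simpleFlat J ⊆ (H : Set V) ↔
      H ∈ Set.range e := by
    rintro ⟨_, r, hr, rfl⟩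
    constructor
    · intro h
      refine ⟨⟨w * r * w⁻¹, hr.conj w, R.mem_parabolic_of_image_simpleFlat_subset h⟩, ?_⟩
      apply Subtype.ext
      change R.hyperplane (w⁻¹ * (w * r * w⁻¹) * w) = _
      congr 1
      group
    · rintro ⟨u, hu⟩
      rw [← hu]
      rintro _ ⟨y, hy, rfl⟩
      change _ ∈ R.hyperplane (w⁻¹ * u * w)
      rw [R.mem_hyperplane_conj, R.rep_rep_inv]
      exact R.rep_eq_self_of_mem_parabolic u.2.2 hy
  unfold HypArr.weight
  simp only [hrange]
  exact finprod_mem_range he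

end Realization
end CoxeterSystem

/-! ### The theorem -/

theorem theorem1 {B W V : Type*} [Finite B] [Group W] [Finite W] {M : CoxeterMatrix B}
    (cs : CoxeterSystem M W) [NormedAddCommGroup V] [InnerProductSpace ℝ V]
    [FiniteDimensional ℝ V] (R : cs.Realization V) :
    (∀ E ∈ HypArr.edges R.arrangement, ∀ H ∈ R.arrangement, E ⊆ H →
      (HypArr.multiplicity R.arrangement E H ≠ 0 ↔
        ∃ J ⊆ cs.simples, CoxeterSystem.IsIrreducible J ∧
          ∃ w : W, E = R.edge (CoxeterSystem.conjSet (cs.reflectionsIn J) w))) ∧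
    (∀ J ⊆ cs.simples, CoxeterSystem.IsIrreducible J → ∀ w : W, ∀ E : Set V,
      E = R.edge (CoxeterSystem.conjSet (cs.reflectionsIn J) w) →
      E ∈ HypArr.edges R.arrangement ∧
      HypArr.weight R.arrangement E =
        ∏ᶠ u : cs.reflectionsIn J, R.var (w⁻¹ * u * w) (cs.isReflection_conj_of_mem u.2 w) ∧
      (∃ t s v : W, cs.IsReflection t ∧ cs.support t = J ∧ cs.IsReducedConj t s v) ∧
      ∀ t s v : W, cs.IsReflection t → cs.support t = J → cs.IsReducedConj t s v →
        ∀ H ∈ R.arrangement, E ⊆ H →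
          HypArr.multiplicity R.arrangement E H =
            (cs.sameSupportConjugates t).ncard * (cs.coxeterClass J).ncard *
              (cs.normalizerReps cs.simples J).ncard * (cs.normalizerReps J {s}).ncard) := by
  constructor
  · rintro E - _ ⟨r, hr, rfl⟩ hE
    rw [R.multiplicity_eq E hr, div_ne_zero_iff, Nat.cast_ne_zero, and_iff_left two_ne_zero,
      ← Nat.pos_iff_ne_zero, Set.ncard_pos (Set.toFinite _)]
    constructor
    · rintro ⟨w, rfl⟩
      have ht : cs.IsReflection (w⁻¹ * r * w) := by simpa using hr.conj w⁻¹
      exact ⟨_, Set.image_subset_range _ _, R.isIrreducible_rootSupport ht, w⁻¹, by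
        rw [R.edge_conjSet_reflectionsIn, inv_inv]⟩
    · rintro ⟨J, hJ, hirr, w, rfl⟩
      obtain ⟨J, rfl⟩ := Set.subset_range_iff_exists_image_eq.mp hJ
      rw [R.edge_conjSet_reflectionsIn] at hE ⊢
      obtain ⟨u, hu, hsupp⟩ := R.exists_conj_rootSupport_eq hirr (hr.conj w)
        (R.mem_parabolic_of_image_simpleFlat_subset hE)
      refine ⟨w⁻¹ * u, ?_⟩
      change R.rep (w⁻¹ * u) '' R.simpleFlat (R.rootSupport ((w⁻¹ * u)⁻¹ * r * (w⁻¹ * u))) = _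
      rw [show (w⁻¹ * u)⁻¹ * r * (w⁻¹ * u) = u⁻¹ * (w * r * w⁻¹) * u by group, hsupp]
      conv_rhs => rw [← R.image_simpleFlat_of_mem_parabolic hu, Set.image_image]
      simp only [R.rep_mul_apply]
  · rintro J hJ hirr w E rfl
    obtain ⟨J, rfl⟩ := Set.subset_range_iff_exists_image_eq.mp hJ
    rw [R.edge_conjSet_reflectionsIn]
    have hne : J.Nonempty := Set.image_nonempty.mp hirr.1
    refine ⟨R.image_simpleFlat_mem_edges hne w⁻¹, R.weight_eq J w, ?_, ?_⟩
    · obtain ⟨j, hj⟩ := hne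
      obtain ⟨u, hu, hsupp⟩ := R.exists_conj_rootSupport_eq hirr (cs.isReflection_simple j)
        (CoxeterSystem.Realization.simple_mem_parabolic hj)
      have ht : cs.IsReflection (u⁻¹ * cs.simple j * u) := by
        simpa using (cs.isReflection_simple j).conj u⁻¹
      obtain ⟨s, v, hsv⟩ := R.exists_isReducedConj ht
      exact ⟨_, s, v, ht, by rw [R.support_eq_image_rootSupport ht, hsupp], hsv⟩
    · rintro t s v ht hsupp hsv _ ⟨r, hr, rfl⟩ hE
      have hrs : R.rootSupport t = J := by
        rw [R.support_eq_image_rootSupport ht] at hsupp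
        exact R.simple_injective.image_injective hsupp
      obtain ⟨⟨i, hi, rfl⟩, hv⟩ := R.mem_parabolic_of_isReducedConj hsv hsupp
      -- The reflection coming from the chosen hyperplane is replaced by `t`, although the two may
      -- not be conjugate; the centralizer of `t` is then conjugated by `v` into that of `s`.
      have hcard : (R.fullConjugators J (w * r * w⁻¹)).ncard =
          (cs.sameSupportConjugates t).ncard *
            (2 * (cs.normalizerReps (cs.simple '' J) {cs.simple i}).ncard) := by
        rw [R.ncard_fullConjugators_eq (t := t), R.ncard_fullConjugators_eq_mul hirr ht hrs,
          ← R.ncard_parabolicCentralizer_simple hi, hsv.2.1,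
          CoxeterSystem.Realization.ncard_parabolicCentralizer_conj _ _ hv]
        · exact CoxeterSystem.Realization.mem_reflectionFinset.mpr
            ⟨hr.conj w, R.mem_parabolic_of_image_simpleFlat_subset hE⟩
        · exact CoxeterSystem.Realization.mem_reflectionFinset.mpr
            ⟨ht, (R.mem_parabolic_iff_rootSupport_subset ht).mpr hrs.le⟩
      rw [R.multiplicity_image_simpleFlat hr hE, hcard, R.ncard_carriesRoots]
      push_cast
      ring
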